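/- **Definitions.** Let $V$ be an $N$-dimensional complex vector space of meromorphic functions on $\mathbb C$. The exponents of $V$ at a point are the orders at this point of the nonzero elements of $V$; there are $N$ of them. A point is singular for $V$ if its set of exponents is not $\{0,\dots,N-1\}$. Let $\bar D_V$ be the monic linear differential operator of order $N$ with meromorphic coefficients that annihilates $V$, let $\mathrm{Wr}_V$ be the Wronskian of a basis of $V$ (defined up to a nonzero constant factor), and let $V^\star$ be the span of all functions $\mathrm{Wr}(f_1,\dots,f_{N-1})/\mathrm{Wr}_V$ with $f_1,\dots,f_{N-1}\in V$. Let $N,M>1$, let $\boldsymbol\lambda=(\lambda_1,\dots,\lambda_N)$ and $\boldsymbol z=(z_1,\dots,z_M)$ be tuples of distinct complex numbers, and let $\boldsymbol n=(n_1,\dots,n_N)$ and $\boldsymbol m=(m_1,\dots,m_M)$ be tuples of nonnegative integers. A pair $(V,\boldsymbol z)$ is a *special space of $(\boldsymbol\lambda,\boldsymbol z,\boldsymbol n,\boldsymbol m)$-type* if $V$ is spanned by functions $p_i(x)e^{\lambda_i x}$, $i=1,\dots,N$, where $p_i\in\mathbb C[x]$ has degree $n_i$, all singular points of $V$ are among $z_1,\dots,z_M$,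 and for every $a$ the set of exponents of $V$ at $z_a$ is $\{0<1<\dots<N-2<N-1+m_a\}$. Its *special fundamental operator* is $\tilde D_V=\prod_{a=1}^M(x-z_a)\,\bar D_V$. Its *special integral transform* is the complex vector space $U$ spanned by the functions $$\hat f_a(u)=\int_{\gamma_a}e^{ux}f(x)\prod_{b=1}^M(x-z_b)^{-1}\,dx,\qquad a=1,\dots,M,\quad f\in V^\star,$$ where $\gamma_a$ is a counterclockwise circle centered at $z_a$, so small that none of the points $z_b$ with $b\ne a$ lies on it or inside it. **Theorem.** Let $(V,\boldsymbol z)$ be a special space of $(\boldsymbol\lambda,\boldsymbol z,\boldsymbol n,\boldsymbol m)$-type and let $U$ be its special integral transform. Then: 1. $\dim U=M$. 2. For every $a=1,\dots,M$ the space $U$ contains a function $q_a(u)e^{z_a u}$, where $q_a$ is a polynomial of degree $m_a$. 3. All singular points of $U$ are among $\lambda_1,\dots,\lambda_N$. 4. For every $i=1,\dots,N$ the set of exponents of $U$ at $\lambda_i$ is $\{0<1<\dots<M-2<M-1+n_i\}$, and $(U,\boldsymbol\lambda)$ is a special space of $(\boldsymbol z,\boldsymbol\lambda,\boldsymbol m,\boldsymbol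 n)$-type. 5. The special fundamental operator of $(V,\boldsymbol z)$ has the form $\tilde D_V=\sum_{i=0}^M\sum_{j=0}^N A_{ij}\,x^i\partial_x^j$ with $A_{ij}\in\mathbb C$, and then $\sum_{i=0}^M\sum_{j=0}^N A_{ij}\,u^j\partial_u^i$ is the special fundamental operator of $(U,\boldsymbol\lambda)$. 6. (Involutivity) The special integral transform of $(U,\boldsymbol\lambda)$ is $V$. -/

import Mathlib

open Filter Polynomial

namespace SpecialSpaces

/-- The exponents of a space `V` of meromorphic functions at the point `x`: the set of all orders
at `x` of elements of `V` that do not vanish identically near `x`. -/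
def exponents (V : Submodule ℂ (ℂ → ℂ)) (x : ℂ) : Set ℤ :=
  {e | ∃ f ∈ V, MeromorphicAt f x ∧ meromorphicOrderAt f x = (e : WithTop ℤ)}

/-- A singular point of an `N`-dimensional space `V`: the set of exponents differs from
`{0, …, N - 1}`. -/
def IsSingularPoint (N : ℕ) (V : Submodule ℂ (ℂ → ℂ)) (x : ℂ) : Prop :=
  exponents V x ≠ Set.Ico (0 : ℤ) N

/-- The Wronskian of a finite sequence of functions; the `i`-th row of the matrix is
`f i, (f i)', …, (f i)^(k-1)`. -/
noncomputable def wronskian {k : ℕ} (f : Fin k → ℂ → ℂ) (x : ℂ) : ℂ :=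
  (Matrix.of fun i j : Fin k => iteratedDeriv (j : ℕ) (f i) x).det

/-- The conjugate space of an `N`-dimensional space `V`: the span of all quotients
`Wr(f₁, …, f_{N-1}) / Wr_V` with `fᵢ ∈ V`, where `Wr_V` is the Wronskian of a basis of `V`
(another basis changes `Wr_V` by a nonzero constant factor only). -/
noncomputable def conjugateSpace (N : ℕ) (V : Submodule ℂ (ℂ → ℂ)) : Submodule ℂ (ℂ → ℂ) :=
  Submodule.span ℂ {g | ∃ (b : Module.Basis (Fin N) ℂ V) (f : Fin (N - 1) → ℂ → ℂ),
    (∀ i, f i ∈ V) ∧ g = fun x => wronskian f x / wronskian (fun i => (b i : ℂ → ℂ)) x}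

/-- `V` (together with the tuple `z`) is a special space of `(lam, z, n, m)`-type. -/
structure IsSpecialSpace {N M : ℕ} (lam : Fin N → ℂ) (z : Fin M → ℂ) (n : Fin N → ℕ)
    (m : Fin M → ℕ) (V : Submodule ℂ (ℂ → ℂ)) : Prop where
  one_lt_N : 1 < N
  one_lt_M : 1 < M
  lam_injective : Function.Injective lam
  z_injective : Function.Injective z
  /-- `V` is spanned by quasi-polynomials `pᵢ(x) exp(λᵢ x)` with `deg pᵢ = nᵢ`. -/
  exists_span : ∃ p : Fin N → ℂ[X], (∀ i, (p i).degree = n i) ∧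
    V = Submodule.span ℂ (Set.range fun i => fun x : ℂ => (p i).eval x * Complex.exp (lam i * x))
  /-- All singular points of `V` are among the `z a`. -/
  singular : ∀ x, IsSingularPoint N V x → x ∈ Set.range z
  /-- The exponents at `z a` are `0 < 1 < … < N - 2 < N - 1 + m a`. -/
  exponents_eq : ∀ a, exponents V (z a) = insert ((N : ℤ) - 1 + m a) (Set.Icc 0 ((N : ℤ) - 2))

/-- The differential operator `∑ j, c j (d/dx)^j` with meromorphic coefficients is the monic
fundamental operator of the space `V`: `dim V = N`, the operator is monic of order `N`, and it
annihilates `V`. Identities of meromorphic functions are identities off a discrete closed set. -/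
structure IsMonicFundamentalOperator (N : ℕ) (V : Submodule ℂ (ℂ → ℂ))
    (c : Fin (N + 1) → ℂ → ℂ) : Prop where
  finrank_eq : Module.finrank ℂ V = N
  meromorphic : ∀ j x, MeromorphicAt (c j) x
  monic : c (Fin.last N) =ᶠ[codiscrete ℂ] fun _ => 1
  annihilates : ∀ f ∈ V,
    (fun x => ∑ j, c j x * iteratedDeriv (j : ℕ) f x) =ᶠ[codiscrete ℂ] fun _ => 0

/-- The differential operator `∑ i j, A i j x^i (d/dx)^j` is the special fundamental operator
`∏ a, (x - z a) • D` of `(V, z)`, where `D` is the monic fundamental operator of `V`. -/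
def IsSpecialFundamentalOperator {N M : ℕ} (z : Fin M → ℂ) (V : Submodule ℂ (ℂ → ℂ))
    (A : Matrix (Fin (M + 1)) (Fin (N + 1)) ℂ) : Prop :=
  ∃ c : Fin (N + 1) → ℂ → ℂ, IsMonicFundamentalOperator N V c ∧
    ∀ j, (fun x => ∑ i, A i j * x ^ (i : ℕ)) =ᶠ[codiscrete ℂ]
      fun x => (∏ a, (x - z a)) * c j x

/-- The circles with centres `z a` and radii `r a` are small: the closed disc around `z a`
contains no other `z b`. -/
def SmallRadii {M : ℕ} (z : Fin M → ℂ) (r : Fin M → ℝ) : Prop :=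
  ∀ a, 0 < r a ∧ ∀ b, b ≠ a → r a < dist (z b) (z a)

/-- The special integral transform of the `N`-dimensional space `V` with the marked points `z`,
along the counterclockwise circles of centre `z a` and radius `r a`: the span of all functions
`u ↦ ∮ exp(u x) f(x) ∏ b, (x - z b)⁻¹ dx` with `f` in the conjugate space of `V`. -/
noncomputable def specialTransform (N : ℕ) {M : ℕ} (V : Submodule ℂ (ℂ → ℂ)) (z : Fin M → ℂ)
    (r : Fin M → ℝ) : Submodule ℂ (ℂ → ℂ) :=
  Submodule.span ℂ {g | ∃ a, ∃ f ∈ conjugateSpace N V,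
    g = fun u => ∮ x in C(z a, r a), Complex.exp (u * x) * f x * ∏ b, (x - z b)⁻¹}

end SpecialSpaces

/-! Everything rests on one operator $\tilde D=\sum A_{ij}x^i\partial_x^j$ and its transpose $\sum
A_{ij}u^j\partial_u^i$. On $e^{ux}$ both act as multiplication by $\sum A_{ij}x^iu^j$, so the
Laplace kernel exchanges them.

Existence of $A$ (`IsSpecialSpace.exists_operator`): Cramer's rule gives the coefficients of the
monic operator as quotients of generalized Wronskians of the quasi-polynomials. At $z_a$ the
denominator vanishes to order exactly $m_a$ and the numerators to order at least $m_a-1$, so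
$\prod(x-z_a)$ clears all poles. The degrees of these Wronskians are at most $\sum n_i$, with
equality for the ordinary one because its top coefficient is a Vandermonde determinant; hence the
quotients are polynomials of degree at most $M$.

The transform (`IsSpecialSpace.exists_transform_eq`): in a basis of $V$ of orders
$0,\dots,N-2,N-1+m_a$ at $z_a$, all dual functions but one give integrands regular at $z_a$; the
last gives a pole of order $m_a+1$, whose residue is $q_a(u)e^{z_au}$ with $\deg q_a=m_a$. So $U$ is
the span of these functions. The transposed operator annihilates $U$, because by variation of
parameters the integrand becomes an exact derivative (`hasDerivAt_variation_of_parameters`).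

Exponents of $U$ (`dual_exponents`): the two highest powers of $x$ in $\tilde
D(p_ie^{\lambda_ix})=0$ show that the leading coefficient of the transpose vanishes at $\lambda_i$
and that the residue there is $-n_i$. The indicial equation then allows only the orders
$0,\dots,M-2,M-1+n_i$, and $\dim U=M$ forces all of them to occur.

Involutivity: the second transform is annihilated by the transpose of the transpose, which is
$\tilde D$, and has the dimension $N$ of $V$. An operator of order $N$ cannot annihilate two such
spaces of entire functions (`eq_of_annihilates`). -/

namespace SpecialSpaces

/-! ### Orders of vanishing of entire functions -/

/-- `f` is `(y - x) ^ s` times an entire function. -/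
def VanishesTo (f : ℂ → ℂ) (x : ℂ) (s : ℕ) : Prop :=
  ∃ h : ℂ → ℂ, Differentiable ℂ h ∧ ∀ y, f y = (y - x) ^ s * h y

/-- `f` is `(y - x) ^ s` times an entire function that does not vanish at `x`. -/
def HasZeroOfOrder (f : ℂ → ℂ) (x : ℂ) (s : ℕ) : Prop :=
  ∃ h : ℂ → ℂ, Differentiable ℂ h ∧ h x ≠ 0 ∧ ∀ y, f y = (y - x) ^ s * h y

theorem HasZeroOfOrder.vanishesTo {f : ℂ → ℂ} {x : ℂ} {s : ℕ} (hf : HasZeroOfOrder f x s) :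
    VanishesTo f x s := by
  obtain ⟨h, h1, -, h2⟩ := hf
  exact ⟨h, h1, h2⟩

theorem eq_of_eq_off_point {f g : ℂ → ℂ} (hf : Continuous f) (hg : Continuous g) {x : ℂ}
    (h : ∀ y, y ≠ x → f y = g y) : f = g :=
  Continuous.ext_on (dense_compl_singleton x) hf hg fun y hy => h y hy

theorem mul_pow_cancel {f g : ℂ → ℂ} (hf : Continuous f) (hg : Continuous g) {x : ℂ} {s : ℕ}
    (h : ∀ y, (y - x) ^ s * f y = (y - x) ^ s * g y) (y : ℂ) : f y = g y := by
  refine congrFun (eq_of_eq_off_point hf hg (x := x) fun y hy => ?_) y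
  exact mul_left_cancel₀ (pow_ne_zero _ (sub_ne_zero.2 hy)) (h y)

/-- Agreement off a discrete closed set holds in a punctured neighbourhood of each point, so the
limits there agree. This turns the codiscrete identities of the definitions into pointwise ones. -/
theorem eq_of_codiscrete {f g : ℂ → ℂ} (hf : Continuous f) (hg : Continuous g)
    (h : f =ᶠ[codiscrete ℂ] g) : f = g := by
  ext x
  have h1 : ∀ᶠ y in nhdsWithin x {x}ᶜ, f y = g y := by
    have := (mem_codiscreteWithin_iff_forall_mem_nhdsNE).1 h x (Set.mem_univ x)
    simpa [Filter.Eventually] using this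
  exact tendsto_nhds_unique_of_eventuallyEq (hf.continuousAt.tendsto.mono_left nhdsWithin_le_nhds)
    (hg.continuousAt.tendsto.mono_left nhdsWithin_le_nhds) h1

theorem eventually_codiscrete_of_finite {s : Set ℂ} (hs : s.Finite) {p : ℂ → Prop}
    (h : ∀ x, x ∉ s → p x) : ∀ᶠ x in codiscrete ℂ, p x :=
  Filter.mem_of_superset hs.compl_mem_codiscrete fun x hx => h x hx

/-- The identity theorem makes the order finite. The entire cofactor is the quotient by `(y - x) ^
s`, completed at `x` by the value of the local analytic cofactor. -/
theorem exists_hasZeroOfOrder {f : ℂ → ℂ} (hf : Differentiable ℂ f) (h0 : f ≠ 0) (x : ℂ) :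
    ∃ s, HasZeroOfOrder f x s := by
  have ha : AnalyticAt ℂ f x := hf.analyticAt x
  have hne : analyticOrderAt f x ≠ ⊤ := by
    intro ht
    rw [analyticOrderAt_eq_top] at ht
    apply h0
    have := AnalyticOnNhd.eq_of_eventuallyEq (f := f) (g := 0) (z₀ := x)
      (fun y _ => hf.analyticAt y) (fun y _ => analyticAt_const) ht
    exact this
  obtain ⟨g, hg, hgx, hfg⟩ := (ha.analyticOrderAt_ne_top).1 hne
  set s := analyticOrderNatAt f x
  refine ⟨s, fun y => if y = x then g x else f y / (y - x) ^ s, ?_, ?_, ?_⟩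
  · intro y
    by_cases hy : y = x
    · subst hy
      refine hg.differentiableAt.congr_of_eventuallyEq ?_
      filter_upwards [hfg] with w hw
      by_cases hwy : w = y
      · simp [hwy]
      · simp only [hwy, if_false]
        rw [hw, smul_eq_mul, mul_div_cancel_left₀ _ (pow_ne_zero _ (sub_ne_zero.2 hwy))]
    · have : DifferentiableAt ℂ (fun y => f y / (y - x) ^ s) y :=
        (hf y).div (by fun_prop) (pow_ne_zero _ (sub_ne_zero.2 hy))
      refine this.congr_of_eventuallyEq ?_
      filter_upwards [isOpen_compl_singleton.mem_nhds hy] with w hw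
      simp [show w ≠ x from hw]
  · simpa using hgx
  · intro y
    by_cases hy : y = x
    · subst hy
      have := hfg.self_of_nhds
      simpa using this
    · simp only [hy, if_false]
      rw [mul_div_cancel₀ _ (pow_ne_zero _ (sub_ne_zero.2 hy))]

theorem HasZeroOfOrder.differentiable {f : ℂ → ℂ} {x : ℂ} {s : ℕ} (hf : HasZeroOfOrder f x s) :
    Differentiable ℂ f := by
  obtain ⟨h, h1, -, h2⟩ := hf
  rw [show f = fun y => (y - x) ^ s * h y from funext h2]
  fun_prop

theorem HasZeroOfOrder.meromorphicOrderAt_eq {f : ℂ → ℂ} {x : ℂ} {s : ℕ}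
    (hf : HasZeroOfOrder f x s) : meromorphicOrderAt f x = ((s : ℤ) : WithTop ℤ) := by
  have hd := hf.differentiable
  obtain ⟨h, h1, h2, h3⟩ := hf
  rw [meromorphicOrderAt_eq_int_iff (hd.analyticAt x).meromorphicAt]
  refine ⟨h, h1.analyticAt x, h2, Eventually.of_forall fun y => ?_⟩
  simp [h3 y]

theorem mem_exponents_iff {V : Submodule ℂ (ℂ → ℂ)} (hV : ∀ f ∈ V, Differentiable ℂ f) (x : ℂ)
    (e : ℤ) : e ∈ exponents V x ↔ ∃ f ∈ V, ∃ s : ℕ, e = s ∧ HasZeroOfOrder f x s := by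
  constructor
  · rintro ⟨f, hf, hm, ho⟩
    have h0 : f ≠ 0 := by
      rintro rfl
      have : meromorphicOrderAt (0 : ℂ → ℂ) x = ⊤ := by
        rw [meromorphicOrderAt_eq_top_iff]; simp
      rw [this] at ho
      exact absurd ho (by simp)
    obtain ⟨s, hs⟩ := exists_hasZeroOfOrder (hV f hf) h0 x
    refine ⟨f, hf, s, ?_, hs⟩
    rw [hs.meromorphicOrderAt_eq] at ho
    exact (WithTop.coe_injective ho).symm
  · rintro ⟨f, hf, s, rfl, hs⟩
    exact ⟨f, hf, ((hV f hf).analyticAt x).meromorphicAt, hs.meromorphicOrderAt_eq⟩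

theorem differentiable_iteratedDeriv {f : ℂ → ℂ} (hf : Differentiable ℂ f) (i : ℕ) :
    Differentiable ℂ (iteratedDeriv i f) :=
  (hf.contDiff (n := ⊤)).differentiable_iteratedDeriv i (by exact_mod_cast WithTop.coe_lt_top _)

theorem iteratedDeriv_sum_smul {ι : Type*} [Fintype ι] {F : ι → ℂ → ℂ}
    (hF : ∀ i, Differentiable ℂ (F i)) (c : ι → ℂ) (j : ℕ) (x : ℂ) :
    iteratedDeriv j (∑ i, c i • F i) x = ∑ i, c i * iteratedDeriv j (F i) x := by
  induction j generalizing x with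
  | zero => simp
  | succ j ih =>
    simp only [iteratedDeriv_succ]
    rw [show iteratedDeriv j (∑ i, c i • F i) = fun x => ∑ i, c i * iteratedDeriv j (F i) x from
      funext ih]
    rw [deriv_fun_sum fun i _ => ((differentiable_iteratedDeriv (hF i) j) x).const_mul _]
    exact Finset.sum_congr rfl fun i _ =>
      deriv_const_mul _ ((differentiable_iteratedDeriv (hF i) j) x)

/-- `(y - x) ^ i` times the `i`-th derivative of `(y - x) ^ s * h y`, with its leading term. -/
theorem exists_pow_mul_iteratedDeriv {f h : ℂ → ℂ} {x : ℂ} {s : ℕ} (hh : Differentiable ℂ h)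
    (hf : ∀ y, f y = (y - x) ^ s * h y) (i : ℕ) :
    ∃ k : ℂ → ℂ, Differentiable ℂ k ∧ k x = (∏ l ∈ Finset.range i, ((s : ℂ) - l)) * h x ∧
      ∀ y, (y - x) ^ i * iteratedDeriv i f y = (y - x) ^ s * k y := by
  induction i with
  | zero => exact ⟨h, hh, by simp, by simpa using hf⟩
  | succ i ih =>
    obtain ⟨k, hk, hkx, hfk⟩ := ih
    have hfd : Differentiable ℂ f := by
      rw [show f = fun y => (y - x) ^ s * h y from funext hf]; fun_prop
    have hdk : Differentiable ℂ (deriv k) := by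
      simpa using differentiable_iteratedDeriv hk 1
    refine ⟨fun y => ((s : ℂ) - i) * k y + (y - x) * deriv k y, by fun_prop, ?_, fun y => ?_⟩
    · simp only [sub_self, zero_mul, add_zero, Finset.prod_range_succ, hkx]; ring
    · have h1 : HasDerivAt (fun y => (y - x) ^ i * iteratedDeriv i f y)
          (i * (y - x) ^ (i - 1) * iteratedDeriv i f y + (y - x) ^ i * iteratedDeriv (i + 1) f y)
          y := by
        have := (((hasDerivAt_id y).sub_const x).fun_pow i).fun_mul
          ((differentiable_iteratedDeriv hfd i) y).hasDerivAt
        simpa [iteratedDeriv_succ] using this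
      have h2 : HasDerivAt (fun y => (y - x) ^ s * k y)
          (s * (y - x) ^ (s - 1) * k y + (y - x) ^ s * deriv k y) y := by
        have := (((hasDerivAt_id y).sub_const x).fun_pow s).fun_mul (hk y).hasDerivAt
        simpa using this
      rw [funext hfk] at h1
      have h3 := h1.unique h2
      -- The factor `y - x` restores the exponent lost on differentiation; at `n = 0`, where `n - 1`
      -- is truncated, both sides vanish.
      have h4 : ∀ n : ℕ, (y - x) * (n * (y - x) ^ (n - 1)) = n * (y - x) ^ n := by
        rintro (_ | n)
        · simp
        · simp only [Nat.add_sub_cancel, pow_succ]; ring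
      have h5 := hfk y
      have h6 := congrArg (fun w => (y - x) * w) h3
      simp only [mul_add, ← mul_assoc] at h6
      have h4i := h4 i
      have h4s := h4 s
      rw [← mul_assoc] at h4i h4s
      rw [h4i, h4s] at h6
      rw [pow_succ]
      linear_combination h6 - (i : ℂ) * h5

theorem VanishesTo.iteratedDeriv {f : ℂ → ℂ} {x : ℂ} {s i : ℕ} (hf : VanishesTo f x s)
    (hi : i ≤ s) : VanishesTo (iteratedDeriv i f) x (s - i) := by
  obtain ⟨h, hh, hfh⟩ := hf
  have hfd : Differentiable ℂ f := by
    rw [show f = fun y => (y - x) ^ s * h y from funext hfh]; fun_prop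
  obtain ⟨k, hk, -, hfk⟩ := exists_pow_mul_iteratedDeriv hh hfh i
  refine ⟨k, hk, mul_pow_cancel (x := x) (s := i) (differentiable_iteratedDeriv hfd i).continuous
    (by have := hk.continuous; fun_prop) fun y => ?_⟩
  rw [hfk y, ← mul_assoc, ← pow_add, Nat.add_sub_cancel' hi]

theorem HasZeroOfOrder.iteratedDeriv {f : ℂ → ℂ} {x : ℂ} {s i : ℕ} (hf : HasZeroOfOrder f x s)
    (hi : i ≤ s) : HasZeroOfOrder (iteratedDeriv i f) x (s - i) := by
  have hfd := hf.differentiable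
  obtain ⟨h, hh, hx, hfh⟩ := hf
  obtain ⟨k, hk, hkx, hfk⟩ := exists_pow_mul_iteratedDeriv hh hfh i
  refine ⟨k, hk, ?_, mul_pow_cancel (x := x) (s := i)
    (differentiable_iteratedDeriv hfd i).continuous
    (by have := hk.continuous; fun_prop) fun y => ?_⟩
  · rw [hkx]
    refine mul_ne_zero (Finset.prod_ne_zero_iff.2 fun l hl => sub_ne_zero.2 ?_) hx
    have := Finset.mem_range.1 hl
    exact_mod_cast (by omega : s ≠ l)
  · rw [hfk y, ← mul_assoc, ← pow_add, Nat.add_sub_cancel' hi]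

theorem HasZeroOfOrder.apply_ne_zero {f : ℂ → ℂ} {x : ℂ} (hf : HasZeroOfOrder f x 0) :
    f x ≠ 0 := by
  obtain ⟨h, -, hx, hfh⟩ := hf
  simpa [hfh x] using hx

theorem VanishesTo.apply_eq_zero {f : ℂ → ℂ} {x : ℂ} {s : ℕ} (hf : VanishesTo f x s)
    (hs : s ≠ 0) : f x = 0 := by
  obtain ⟨h, -, hfh⟩ := hf
  simp [hfh x, hs]

theorem VanishesTo.mono {f : ℂ → ℂ} {x : ℂ} {s t : ℕ} (hf : VanishesTo f x s)
    (hts : t ≤ s) : VanishesTo f x t := by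
  obtain ⟨h, hh, hfh⟩ := hf
  refine ⟨fun y => (y - x) ^ (s - t) * h y, by fun_prop, fun y => ?_⟩
  rw [hfh y, ← mul_assoc, ← pow_add, Nat.add_sub_cancel' hts]

theorem VanishesTo.mul_right {f g : ℂ → ℂ} {x : ℂ} {s : ℕ} (hf : VanishesTo f x s)
    (hg : Differentiable ℂ g) : VanishesTo (fun y => f y * g y) x s := by
  obtain ⟨h, hh, hfh⟩ := hf
  exact ⟨fun y => h y * g y, by fun_prop, fun y => by simp only [hfh y, mul_assoc]⟩

theorem VanishesTo.sum {ι : Type*} {F : ι → ℂ → ℂ} {S : Finset ι} {x : ℂ} {s : ℕ}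
    (hF : ∀ i ∈ S, VanishesTo (F i) x s) : VanishesTo (fun y => ∑ i ∈ S, F i y) x s := by
  choose! h hh hFh using hF
  refine ⟨fun y => ∑ i ∈ S, h i y, Differentiable.fun_sum fun i hi => hh i hi, fun y => ?_⟩
  rw [Finset.mul_sum]
  exact Finset.sum_congr rfl fun i hi => hFh i hi y

/-- A space of entire functions is no larger than the set of possible orders at a point. -/
theorem finrank_le_card_of_orders {X : Submodule ℂ (ℂ → ℂ)} [Module.Finite ℂ X]
    (hX : ∀ f ∈ X, Differentiable ℂ f) (x : ℂ) (S : Finset ℕ)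
    (hS : ∀ f ∈ X, ∀ s, HasZeroOfOrder f x s → s ∈ S) : Module.finrank ℂ X ≤ S.card := by
  -- Taking derivatives at `x` of orders in `S` is injective: a nonzero element of order `s` has a
  -- nonzero `s`-th derivative at `x`.
  let φ : X →ₗ[ℂ] (S → ℂ) :=
    { toFun := fun f s => iteratedDeriv (s : ℕ) (f : ℂ → ℂ) x
      map_add' := fun f g => by
        funext s
        have := iteratedDeriv_sum_smul (F := ![(f : ℂ → ℂ), g])
          (by intro i; fin_cases i; exacts [hX _ f.2, hX _ g.2]) 1 (s : ℕ) x
        simpa using this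
      map_smul' := fun c f => by
        funext s
        simp }
  have hφ : Function.Injective φ := by
    rw [← LinearMap.ker_eq_bot, LinearMap.ker_eq_bot']
    intro f hf
    by_contra h0
    obtain ⟨s, hs⟩ := exists_hasZeroOfOrder (hX f f.2) (fun h => h0 (Subtype.ext h)) x
    have h1 := congrFun hf ⟨s, hS f f.2 s hs⟩
    have h2 := (hs.iteratedDeriv le_rfl)
    rw [Nat.sub_self] at h2
    exact h2.apply_ne_zero h1
  simpa using LinearMap.finrank_le_finrank_of_injective hφ

/-! ### Indicial equation, exponents and dimension of kernels -/

/-- The differential operator `∑ j, b j (d/dx)^j` annihilates the space `X`. -/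
def Annihilates {M : ℕ} (b : Fin (M + 1) → ℂ → ℂ) (X : Submodule ℂ (ℂ → ℂ)) : Prop :=
  ∀ f ∈ X, ∀ x, ∑ j, b j x * iteratedDeriv (j : ℕ) f x = 0

/-- The indicial equation at a point where the leading coefficient has a zero. -/
theorem indicial_equation {K : ℕ} {b : Fin (K + 1 + 1) → ℂ → ℂ} (hb : ∀ j, Continuous (b j))
    {β : ℂ → ℂ} (hβ : Continuous β) {x : ℂ}
    (hlead : ∀ y, b (Fin.last _) y = (y - x) * β y) {f : ℂ → ℂ} {s : ℕ}
    (hf : HasZeroOfOrder f x s)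
    (hann : ∀ y, ∑ j, b j y * iteratedDeriv (j : ℕ) f y = 0) :
    (∏ l ∈ Finset.range K, ((s : ℂ) - l)) *
      (β x * ((s : ℂ) - K) + b (Fin.last K).castSucc x) = 0 := by
  obtain ⟨h, hh, hx, hfh⟩ := hf
  choose k hk hkx hfk using fun i => exists_pow_mul_iteratedDeriv hh hfh i
  have hkc : ∀ i, Continuous (k i) := fun i => (hk i).continuous
  -- The equation is multiplied by `(y - x) ^ K` and then divided by `(y - x) ^ s`. The simple zero
  -- of the leading coefficient supplies the extra power for the derivative of order `K + 1`, so at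
  -- `x` only the two highest terms survive.
  have key := mul_pow_cancel (x := x) (s := s)
    (f := fun y => ∑ j : Fin K, b j.castSucc.castSucc y * (y - x) ^ (K - (j : ℕ)) * k j y
      + b (Fin.last K).castSucc y * k K y + β y * k (K + 1) y) (g := fun _ => 0)
    (by fun_prop) (by fun_prop) (fun y => by
      have h1 := hann y
      rw [Fin.sum_univ_castSucc, Fin.sum_univ_castSucc] at h1
      have h2 := congrArg (fun w => (y - x) ^ K * w) h1
      simp only [mul_add, mul_zero, Finset.mul_sum, Fin.val_castSucc, Fin.val_last, hlead] at h2 ⊢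
      rw [← h2]
      congr 1
      · congr 1
        · refine Finset.sum_congr rfl fun j _ => ?_
          have h3 := hfk j y
          have h4 : (y - x) ^ K = (y - x) ^ (K - (j : ℕ)) * (y - x) ^ (j : ℕ) := by
            rw [← pow_add, Nat.sub_add_cancel j.2.le]
          rw [h4]
          linear_combination (-(b j.castSucc.castSucc y * (y - x) ^ (K - (j : ℕ)))) * h3
        · linear_combination (-(b (Fin.last K).castSucc y)) * hfk K y
      · have h3 := hfk (K + 1) y
        rw [pow_succ] at h3
        linear_combination (-(β y)) * h3) x
  have h0 : ∑ j : Fin K, b j.castSucc.castSucc x * (x - x) ^ (K - (j : ℕ)) * k j x = 0 := by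
    refine Finset.sum_eq_zero fun j _ => ?_
    rw [sub_self, zero_pow (Nat.sub_ne_zero_of_lt j.2)]
    ring
  beta_reduce at key
  rw [h0, hkx, hkx, Finset.prod_range_succ, zero_add] at key
  refine (mul_eq_zero.1 (?_ : _ * h x = 0)).resolve_right hx
  linear_combination key

theorem order_of_indicial {K s n : ℕ} {β b : ℂ} (hβ : β ≠ 0) (hb : b = -n * β)
    (h : (∏ l ∈ Finset.range K, ((s : ℂ) - l)) * (β * ((s : ℂ) - K) + b) = 0) :
    s ∈ insert (K + n) (Finset.range K) := by
  rcases mul_eq_zero.1 h with h | h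
  · obtain ⟨l, hl, hsl⟩ := Finset.prod_eq_zero_iff.1 h
    have : s = l := by exact_mod_cast sub_eq_zero.1 hsl
    exact Finset.mem_insert_of_mem (this ▸ hl)
  · have h1 : β * ((s : ℂ) - (K + n : ℕ)) = 0 := by
      rw [← h, hb]; push_cast; ring
    have h2 := sub_eq_zero.1 ((mul_eq_zero.1 h1).resolve_left hβ)
    have : s = K + n := by exact_mod_cast h2
    exact this ▸ Finset.mem_insert_self _ _

/-- The exponents of a space of entire functions of full dimension annihilated by a differential
operator whose leading coefficient has a simple zero. -/
theorem exponents_of_annihilates {K n : ℕ} {b : Fin (K + 1 + 1) → ℂ → ℂ}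
    (hb : ∀ j, Continuous (b j)) {β : ℂ → ℂ} (hβ : Continuous β) {x : ℂ}
    (hlead : ∀ y, b (Fin.last _) y = (y - x) * β y) (hβx : β x ≠ 0)
    (hres : b (Fin.last K).castSucc x = -n * β x) {X : Submodule ℂ (ℂ → ℂ)}
    (hX : ∀ f ∈ X, Differentiable ℂ f) (hdim : Module.finrank ℂ X = K + 1)
    (hann : Annihilates b X) :
    exponents X x = insert (((K + 1 : ℕ) : ℤ) - 1 + n) (Set.Icc 0 (((K + 1 : ℕ) : ℤ) - 2)) := by
  classical
  have : Module.Finite ℂ X := Module.finite_of_finrank_pos (by omega)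
  have hord : ∀ f ∈ X, ∀ s, HasZeroOfOrder f x s → s ∈ insert (K + n) (Finset.range K) :=
    fun f hf s hs => order_of_indicial hβx hres (indicial_equation hb hβ hlead hs (hann f hf))
  set S := insert (K + n) (Finset.range K) with hSdef
  have hcard : S.card = K + 1 := by
    rw [hSdef, Finset.card_insert_of_notMem (by simp), Finset.card_range]
  -- `S'` is the set of orders that really occur. The dimension `K + 1` bounds its size from below,
  -- so no admissible order is missing.
  set S' := S.filter fun s => ∃ f ∈ X, HasZeroOfOrder f x s
  have h1 := finrank_le_card_of_orders hX x S' fun f hf s hs =>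
    Finset.mem_filter.2 ⟨hord f hf s hs, f, hf, hs⟩
  have h2 : S' = S := Finset.eq_of_subset_of_card_le (Finset.filter_subset _ _) (by omega)
  ext e
  rw [mem_exponents_iff hX]
  constructor
  · rintro ⟨f, hf, s, rfl, hs⟩
    have := hord f hf s hs
    simp only [hSdef, Finset.mem_insert, Finset.mem_range] at this
    simp only [Set.mem_insert_iff, Set.mem_Icc]
    omega
  · intro he
    simp only [Set.mem_insert_iff, Set.mem_Icc] at he
    obtain ⟨s, rfl⟩ : ∃ s : ℕ, e = s := ⟨e.toNat, by omega⟩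
    have hs : s ∈ S := by
      simp only [hSdef, Finset.mem_insert, Finset.mem_range]
      omega
    rw [← h2] at hs
    obtain ⟨-, f, hf, hfs⟩ := Finset.mem_filter.1 hs
    exact ⟨f, hf, s, rfl, hfs⟩

/-- Multiplying the operator by `y - x` creates a simple zero of the leading coefficient and makes
the next coefficient vanish at `x`; this is the previous situation with `n = 0`. -/
theorem exponents_of_annihilates_of_ne_zero {K : ℕ} {b : Fin (K + 1 + 1) → ℂ → ℂ}
    (hb : ∀ j, Continuous (b j)) {x : ℂ}
    (hbx : b (Fin.last _) x ≠ 0) {X : Submodule ℂ (ℂ → ℂ)}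
    (hX : ∀ f ∈ X, Differentiable ℂ f) (hdim : Module.finrank ℂ X = K + 1)
    (hann : Annihilates b X) :
    exponents X x = Set.Ico (0 : ℤ) (K + 1 : ℕ) := by
  rw [exponents_of_annihilates (n := 0) (b := fun j y => (y - x) * b j y)
    (fun j => by have := hb j; fun_prop) (hb _) (fun y => rfl) hbx (by simp) hX hdim
    (fun f hf y => by
      simp only [mul_assoc]
      rw [← Finset.mul_sum, hann f hf y, mul_zero])]
  ext e
  simp only [Set.mem_insert_iff, Set.mem_Icc, Set.mem_Ico]
  omega

/-- The kernel of an operator of order `K + 1` on entire functions has dimension at most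
`K + 1`. -/
theorem finrank_le_of_annihilates {K : ℕ} {b : Fin (K + 1 + 1) → ℂ → ℂ}
    (hb : ∀ j, Continuous (b j)) {x : ℂ} (hbx : b (Fin.last _) x ≠ 0)
    {X : Submodule ℂ (ℂ → ℂ)} [Module.Finite ℂ X]
    (hX : ∀ f ∈ X, Differentiable ℂ f) (hann : Annihilates b X) :
    Module.finrank ℂ X ≤ K + 1 := by
  have := finrank_le_card_of_orders hX x (insert (K + 0) (Finset.range K)) fun f hf s hs =>
    order_of_indicial hbx (by simp) (indicial_equation (b := fun j y => (y - x) * b j y)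
      (fun j => by have := hb j; fun_prop) (hb _) (fun y => rfl) hs (fun y => by
        simp only [mul_assoc]
        rw [← Finset.mul_sum, hann f hf y, mul_zero]))
  refine this.trans ?_
  simp

/-- The sum `X ⊔ Y` is annihilated too, so its dimension is at most `K + 1`, which `X` and `Y` both
attain already. -/
theorem eq_of_annihilates {K : ℕ} {b : Fin (K + 1 + 1) → ℂ → ℂ}
    (hb : ∀ j, Continuous (b j)) {x : ℂ} (hbx : b (Fin.last _) x ≠ 0)
    {X Y : Submodule ℂ (ℂ → ℂ)} (hX : ∀ f ∈ X, Differentiable ℂ f)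
    (hY : ∀ f ∈ Y, Differentiable ℂ f) (hXa : Annihilates b X) (hYa : Annihilates b Y)
    (hXd : Module.finrank ℂ X = K + 1) (hYd : Module.finrank ℂ Y = K + 1) : X = Y := by
  have : Module.Finite ℂ X := Module.finite_of_finrank_pos (by omega)
  have : Module.Finite ℂ Y := Module.finite_of_finrank_pos (by omega)
  have hd : ∀ f ∈ X ⊔ Y, Differentiable ℂ f := by
    intro f hf
    obtain ⟨g, hg, h, hh, rfl⟩ := Submodule.mem_sup.1 hf
    exact (hX g hg).add (hY h hh)
  have ha : Annihilates b (X ⊔ Y) := by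
    intro f hf y
    obtain ⟨g, hg, h, hh, rfl⟩ := Submodule.mem_sup.1 hf
    have hadd : ∀ j : ℕ, iteratedDeriv j (g + h) y = iteratedDeriv j g y + iteratedDeriv j h y := by
      intro j
      have := iteratedDeriv_sum_smul (F := ![g, h])
        (by intro i; fin_cases i; exacts [hX _ hg, hY _ hh]) 1 j y
      simpa using this
    simp only [hadd, mul_add, Finset.sum_add_distrib, hXa g hg y, hYa h hh y, add_zero]
  have hle := finrank_le_of_annihilates hb hbx hd ha
  have h1 := Submodule.eq_of_le_of_finrank_le (le_sup_left : X ≤ X ⊔ Y) (by omega)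
  have h2 := Submodule.eq_of_le_of_finrank_le (le_sup_right : Y ≤ X ⊔ Y) (by omega)
  exact h1.trans h2.symm

/-! ### Wronskians, the dual family and variation of parameters -/

/-- The matrix of the first `N` derivatives of a family of functions. -/
noncomputable def jets {ι : Type*} (F : ι → ℂ → ℂ) (N : ℕ) (x : ℂ) : Matrix ι (Fin N) ℂ :=
  Matrix.of fun i j => iteratedDeriv (j : ℕ) (F i) x

theorem wronskian_eq_det_jets {k : ℕ} (f : Fin k → ℂ → ℂ) (x : ℂ) :
    wronskian f x = (jets f k x).det := rfl

/-- The last row of the inverse of the Wronskian matrix. -/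
noncomputable def dualFamily {K : ℕ} (F : Fin (K + 1) → ℂ → ℂ) (k : Fin (K + 1)) (x : ℂ) : ℂ :=
  (jets F (K + 1) x)⁻¹ (Fin.last K) k

theorem jets_eq_mul {ι κ : Type*} [Fintype κ] {F : κ → ℂ → ℂ} (hF : ∀ k, Differentiable ℂ (F k))
    {G : ι → ℂ → ℂ} {T : Matrix ι κ ℂ} (hG : ∀ i, G i = ∑ k, T i k • F k) (N : ℕ) (x : ℂ) :
    jets G N x = T * jets F N x := by
  ext i j
  simp only [jets, Matrix.of_apply, Matrix.mul_apply, hG]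
  exact iteratedDeriv_sum_smul hF _ _ _

theorem wronskian_eq_det_mul {N : ℕ} {F G : Fin N → ℂ → ℂ} (hF : ∀ k, Differentiable ℂ (F k))
    {T : Matrix (Fin N) (Fin N) ℂ} (hG : ∀ i, G i = ∑ k, T i k • F k) (x : ℂ) :
    wronskian G x = T.det * wronskian F x := by
  rw [wronskian_eq_det_jets, jets_eq_mul hF hG, Matrix.det_mul, wronskian_eq_det_jets]

theorem differentiable_det {ι : Type*} [Fintype ι] [DecidableEq ι] {A : ℂ → Matrix ι ι ℂ}
    (hA : ∀ i j, Differentiable ℂ fun x => A x i j) : Differentiable ℂ fun x => (A x).det := by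
  simp only [Matrix.det_apply']
  exact Differentiable.fun_sum fun σ _ =>
    (Differentiable.fun_finsetProd fun i _ => hA _ _).const_mul _

theorem differentiable_wronskian {N : ℕ} {F : Fin N → ℂ → ℂ}
    (hF : ∀ k, Differentiable ℂ (F k)) : Differentiable ℂ (wronskian F) :=
  differentiable_det fun _ _ => differentiable_iteratedDeriv (hF _) _

/-- The cofactor formula for the inverse: up to sign, the dual family consists of the quotients of
Wronskians that generate the conjugate space. -/
theorem dualFamily_eq {K : ℕ} (F : Fin (K + 1) → ℂ → ℂ) (k : Fin (K + 1)) (x : ℂ) :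
    dualFamily F k x =
      (-1) ^ ((k : ℕ) + K) * wronskian (fun i => F (k.succAbove i)) x / wronskian F x := by
  rw [dualFamily, Matrix.inv_def, Matrix.smul_apply, Matrix.adjugate_fin_succ_eq_det_submatrix,
    Ring.inverse_eq_inv', smul_eq_mul, div_eq_inv_mul]
  congr 3
  ext i j
  simp [jets]

theorem dualFamily_last {K : ℕ} (F : Fin (K + 1) → ℂ → ℂ) (x : ℂ) :
    dualFamily F (Fin.last K) x = wronskian (fun i => F i.castSucc) x / wronskian F x := by
  rw [dualFamily_eq]
  simp [← two_mul]

/-- Quotients of Wronskians are combinations of the dual family. -/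
theorem wronskian_div_wronskian {K : ℕ} {F : Fin (K + 1) → ℂ → ℂ}
    (hF : ∀ k, Differentiable ℂ (F k)) {f : Fin K → ℂ → ℂ} {S : Matrix (Fin K) (Fin (K + 1)) ℂ}
    (hf : ∀ i, f i = ∑ k, S i k • F k) (x : ℂ) :
    wronskian f x / wronskian F x =
      ∑ k : Fin (K + 1), ((-1) ^ (K + (k : ℕ)) * (S.submatrix id k.succAbove).det) *
        dualFamily F k x := by
  by_cases hW : wronskian F x = 0
  · have : ∀ k, dualFamily F k x = 0 := fun k => by rw [dualFamily_eq, hW, div_zero]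
    simp [hW, this]
  have hu : IsUnit (jets F (K + 1) x).det := isUnit_iff_ne_zero.2 hW
  -- The rows of `S` are completed by the dual family. The last row of `E * jets` is then `(0, …, 0,
  -- 1)`, so the determinant of the product is the Wronskian of `f`, while the expansion of `E.det`
  -- along its last row gives the right-hand side.
  let E : Matrix (Fin (K + 1)) (Fin (K + 1)) ℂ :=
    Matrix.of (Fin.snoc (α := fun _ => Fin (K + 1) → ℂ) (fun i => S i) fun k => dualFamily F k x)
  have hE1 : ∀ k, E (Fin.last K) k = dualFamily F k x := fun k => by simp [E]
  have hE2 : ∀ i k, E (Fin.castSucc i) k = S i k := fun i k => by simp [E]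
  have hdet : E.det = ∑ k : Fin (K + 1), ((-1) ^ (K + (k : ℕ)) *
      (S.submatrix id k.succAbove).det) * dualFamily F k x := by
    rw [Matrix.det_succ_row E (Fin.last K)]
    refine Finset.sum_congr rfl fun k _ => ?_
    have : E.submatrix (Fin.last K).succAbove k.succAbove = S.submatrix id k.succAbove := by
      ext i j; simp [hE2]
    rw [this, hE1, Fin.val_last]; ring
  have hdet2 : (E * jets F (K + 1) x).det = wronskian f x := by
    rw [Matrix.det_succ_row _ (Fin.last K), Finset.sum_eq_single (Fin.last K)]
    · have h1 : (E * jets F (K + 1) x) (Fin.last K) (Fin.last K) = 1 := by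
        have := congrFun (congrFun (Matrix.nonsing_inv_mul _ hu) (Fin.last K)) (Fin.last K)
        rw [Matrix.mul_apply, Matrix.one_apply_eq] at this
        rw [Matrix.mul_apply, ← this]
        exact Finset.sum_congr rfl fun k _ => by rw [hE1]; rfl
      have h2 : (E * jets F (K + 1) x).submatrix (Fin.last K).succAbove (Fin.last K).succAbove =
          jets f K x := by
        rw [jets_eq_mul hF hf]
        ext i j
        simp [Matrix.mul_apply, hE2, jets]
      rw [h1, h2, wronskian_eq_det_jets]
      simp [← two_mul]
    · intro k _ hk
      have h1 : (E * jets F (K + 1) x) (Fin.last K) k = 0 := by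
        have := congrFun (congrFun (Matrix.nonsing_inv_mul _ hu) (Fin.last K)) k
        rw [Matrix.mul_apply, Matrix.one_apply_ne hk.symm] at this
        rw [Matrix.mul_apply, ← this]
        exact Finset.sum_congr rfl fun k _ => by rw [hE1]; rfl
      rw [h1]; ring
    · simp
  rw [← hdet, ← hdet2, Matrix.det_mul, ← wronskian_eq_det_jets, mul_div_cancel_right₀ _ hW]

/-- A family of entire functions with a Wronskian that is not identically zero is linearly
independent. -/
theorem linearIndependent_of_wronskian_ne_zero {N : ℕ} {F : Fin N → ℂ → ℂ}
    (hF : ∀ k, Differentiable ℂ (F k)) {x : ℂ} (hx : wronskian F x ≠ 0) :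
    LinearIndependent ℂ F := by
  rw [Fintype.linearIndependent_iff]
  intro c hc
  have h1 : Matrix.vecMul c (jets F N x) = 0 := by
    ext j
    have h2 := iteratedDeriv_sum_smul hF c (j : ℕ) x
    rw [hc] at h2
    have h3 : iteratedDeriv (j : ℕ) (0 : ℂ → ℂ) x = 0 := by
      simp
    rw [h3] at h2
    simpa [Matrix.vecMul, dotProduct, jets] using h2.symm
  exact congrFun (Matrix.eq_zero_of_vecMul_eq_zero hx h1)

theorem differentiableAt_inv_jets {K : ℕ} {F : Fin (K + 1) → ℂ → ℂ}
    (hF : ∀ k, Differentiable ℂ (F k)) {x : ℂ} (hx : wronskian F x ≠ 0) (j k : Fin (K + 1)) :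
    DifferentiableAt ℂ (fun x => (jets F (K + 1) x)⁻¹ j k) x := by
  have : (fun x => (jets F (K + 1) x)⁻¹ j k) = fun x => (wronskian F x)⁻¹ *
      ((-1) ^ (k + j : ℕ) * ((jets F (K + 1) x).submatrix k.succAbove j.succAbove).det) := by
    ext x
    rw [Matrix.inv_def, Matrix.smul_apply, Matrix.adjugate_fin_succ_eq_det_submatrix,
      Ring.inverse_eq_inv', smul_eq_mul]
    rfl
  rw [this]
  have h1 := differentiable_wronskian hF x
  have h2 : Differentiable ℂ fun x =>
      ((jets F (K + 1) x).submatrix k.succAbove j.succAbove).det :=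
    differentiable_det fun _ _ => differentiable_iteratedDeriv (hF _) _
  exact (h1.inv hx).mul ((h2 x).const_mul _)

/-- Variation of parameters: if `∑ j, b j (d/dx)^j` annihilates the family `F`, then its value on
`φ`, divided by the leading coefficient and multiplied by a member of the dual family, has an
explicit antiderivative. -/
theorem hasDerivAt_variation_of_parameters {K : ℕ} {F : Fin (K + 1) → ℂ → ℂ}
    (hF : ∀ k, Differentiable ℂ (F k)) {b : Fin (K + 1 + 1) → ℂ → ℂ}
    (hb : ∀ k x, ∑ j, b j x * iteratedDeriv (j : ℕ) (F k) x = 0) {φ : ℂ → ℂ}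
    (hφ : Differentiable ℂ φ) {x : ℂ} (hx : wronskian F x ≠ 0) (hbx : b (Fin.last _) x ≠ 0)
    (k : Fin (K + 1)) :
    HasDerivAt (fun x => ∑ j : Fin (K + 1),
        iteratedDeriv (j : ℕ) φ x * (jets F (K + 1) x)⁻¹ j k)
      ((∑ j, b j x * iteratedDeriv (j : ℕ) φ x) / b (Fin.last _) x * dualFamily F k x) x := by
  -- The varied parameters: `U k` are the coordinates of the jet of `φ` in the jets of the `F k`.
  set U : Fin (K + 1) → ℂ → ℂ := fun k x => ∑ j : Fin (K + 1),
    iteratedDeriv (j : ℕ) φ x * (jets F (K + 1) x)⁻¹ j k with hU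
  have hUd : ∀ k, DifferentiableAt ℂ (U k) x := fun k =>
    DifferentiableAt.fun_sum fun j _ => (differentiable_iteratedDeriv hφ _ x).mul
      (differentiableAt_inv_jets hF hx j k)
  have hrel : ∀ y, wronskian F y ≠ 0 → ∀ l : Fin (K + 1),
      ∑ k, U k y * iteratedDeriv (l : ℕ) (F k) y = iteratedDeriv (l : ℕ) φ y := by
    intro y hy l
    have h1 := Matrix.nonsing_inv_mul (jets F (K + 1) y) (isUnit_iff_ne_zero.2 hy)
    have h2 : Matrix.vecMul (Matrix.vecMul (fun j : Fin (K + 1) => iteratedDeriv (j : ℕ) φ y)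
        (jets F (K + 1) y)⁻¹) (jets F (K + 1) y) l = iteratedDeriv (l : ℕ) φ y := by
      rw [Matrix.vecMul_vecMul, h1, Matrix.vecMul_one]
    exact h2
  have hder : ∀ l : Fin (K + 1), ∑ k, deriv (U k) x * iteratedDeriv (l : ℕ) (F k) x =
      iteratedDeriv ((l : ℕ) + 1) φ x - ∑ k, U k x * iteratedDeriv ((l : ℕ) + 1) (F k) x := by
    intro l
    have h1 : HasDerivAt (fun y => ∑ k, U k y * iteratedDeriv (l : ℕ) (F k) y)
        (∑ k, (deriv (U k) x * iteratedDeriv (l : ℕ) (F k) x +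
          U k x * iteratedDeriv ((l : ℕ) + 1) (F k) x)) x := by
      refine HasDerivAt.fun_sum fun k _ => ?_
      rw [iteratedDeriv_succ]
      exact (hUd k).hasDerivAt.fun_mul (differentiable_iteratedDeriv (hF k) _ x).hasDerivAt
    have h2 : HasDerivAt (iteratedDeriv (l : ℕ) φ) (iteratedDeriv ((l : ℕ) + 1) φ x) x := by
      rw [iteratedDeriv_succ]
      exact (differentiable_iteratedDeriv hφ _ x).hasDerivAt
    have h3 : (fun y => ∑ k, U k y * iteratedDeriv (l : ℕ) (F k) y) =ᶠ[nhds x]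
        iteratedDeriv (l : ℕ) φ := by
      filter_upwards [(differentiable_wronskian hF).continuous.continuousAt.eventually_ne hx]
        with y hy using hrel y hy l
    have h4 := h1.unique (h2.congr_of_eventuallyEq h3)
    rw [Finset.sum_add_distrib] at h4
    linear_combination h4
  -- For `l < K` the relation for the next derivative cancels the right side of `hder`. For `l = K`
  -- the derivatives of order `K + 1` of the `F k` are eliminated by the differential equation,
  -- which leaves the operator applied to `φ`.
  have hvec : Matrix.vecMul (fun k => deriv (U k) x) (jets F (K + 1) x) =
      Pi.single (Fin.last K) ((∑ j, b j x * iteratedDeriv (j : ℕ) φ x) / b (Fin.last _) x) := by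
    ext l
    have h1 : Matrix.vecMul (fun k => deriv (U k) x) (jets F (K + 1) x) l =
      ∑ k, deriv (U k) x * iteratedDeriv (l : ℕ) (F k) x := rfl
    rw [h1, hder]
    induction l using Fin.lastCases with
    | last =>
      rw [Pi.single_eq_same, eq_div_iff hbx, sub_mul,
        Fin.sum_univ_castSucc fun j : Fin (K + 1 + 1) => b j x * iteratedDeriv (j : ℕ) φ x]
      have h2 : (∑ k, U k x * iteratedDeriv (K + 1) (F k) x) * b (Fin.last _) x =
          - ∑ j : Fin (K + 1), b j.castSucc x * iteratedDeriv (j : ℕ) φ x := by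
        calc _ = ∑ k, U k x *
              -∑ j : Fin (K + 1), b j.castSucc x * iteratedDeriv (j : ℕ) (F k) x := by
              rw [Finset.sum_mul]
              refine Finset.sum_congr rfl fun k _ => ?_
              have h3 := hb k x
              rw [Fin.sum_univ_castSucc] at h3
              simp only [Fin.val_castSucc, Fin.val_last] at h3
              linear_combination U k x * h3
          _ = _ := by
              simp only [← Finset.sum_neg_distrib, Finset.mul_sum]
              rw [Finset.sum_comm]
              refine Finset.sum_congr rfl fun j _ => ?_
              rw [← hrel x hx j, Finset.mul_sum, ← Finset.sum_neg_distrib]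
              exact Finset.sum_congr rfl fun k _ => by ring
      simp only [Fin.val_castSucc, Fin.val_last] at h2 ⊢
      rw [h2]; ring
    | cast l =>
      rw [Pi.single_eq_of_ne (Fin.castSucc_lt_last l).ne]
      have := hrel x hx l.succ
      simp only [Fin.val_succ, Fin.val_castSucc] at this ⊢
      rw [this, sub_self]
  have hsol : (fun k => deriv (U k) x) = Matrix.vecMul (Pi.single (Fin.last K)
      ((∑ j, b j x * iteratedDeriv (j : ℕ) φ x) / b (Fin.last _) x)) (jets F (K + 1) x)⁻¹ := by
    rw [← hvec, Matrix.vecMul_vecMul,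
      Matrix.mul_nonsing_inv (jets F (K + 1) x) (isUnit_iff_ne_zero.2 hx), Matrix.vecMul_one]
  have hk := congrFun hsol k
  rw [Matrix.single_vecMul] at hk
  have hd := (hUd k).hasDerivAt
  rw [hk] at hd
  exact hd

/-- The antiderivative from variation of parameters is single-valued along the circle. This replaces
the statement that the formal adjoint annihilates the conjugate space. -/
theorem circleIntegral_dualFamily_eq_zero {K : ℕ} {F : Fin (K + 1) → ℂ → ℂ}
    (hF : ∀ k, Differentiable ℂ (F k)) {b : Fin (K + 1 + 1) → ℂ → ℂ}
    (hb : ∀ k x, ∑ j, b j x * iteratedDeriv (j : ℕ) (F k) x = 0) {φ : ℂ → ℂ}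
    (hφ : Differentiable ℂ φ) {c : ℂ} {r : ℝ} (hr : 0 ≤ r)
    (hW : ∀ x ∈ Metric.sphere c r, wronskian F x ≠ 0)
    (hbx : ∀ x ∈ Metric.sphere c r, b (Fin.last _) x ≠ 0) (k : Fin (K + 1)) :
    (∮ x in C(c, r), (∑ j, b j x * iteratedDeriv (j : ℕ) φ x) / b (Fin.last _) x *
      dualFamily F k x) = 0 :=
  circleIntegral.integral_eq_zero_of_hasDerivWithinAt hr fun x hx =>
    (hasDerivAt_variation_of_parameters hF hb hφ (hW x hx) (hbx x hx) k).hasDerivWithinAt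

/-! ### Quasi-polynomials and the degrees of their Wronskians -/

/-- The quasi-polynomial `p(x) exp(l x)`. -/
noncomputable def quasiPoly (p : ℂ[X]) (l : ℂ) : ℂ → ℂ :=
  fun x => p.eval x * Complex.exp (l * x)

/-- The action of `d/dx` on the polynomial factor of a quasi-polynomial with exponent `l`. -/
noncomputable def twist (l : ℂ) (p : ℂ[X]) : ℂ[X] := derivative p + C l * p

theorem differentiable_quasiPoly (p : ℂ[X]) (l : ℂ) : Differentiable ℂ (quasiPoly p l) := by
  unfold quasiPoly
  have := p.differentiable
  fun_prop

theorem deriv_quasiPoly (p : ℂ[X]) (l : ℂ) :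
    deriv (quasiPoly p l) = quasiPoly (twist l p) l := by
  ext x
  have h1 : HasDerivAt (fun x => Complex.exp (l * x)) (Complex.exp (l * x) * (l * 1)) x :=
    ((hasDerivAt_id x).const_mul l).cexp
  have h2 := (p.hasDerivAt x).fun_mul h1
  rw [show quasiPoly p l = fun x => p.eval x * Complex.exp (l * x) from rfl, h2.deriv]
  simp only [quasiPoly, twist, eval_add, eval_mul, eval_C]
  ring

theorem iteratedDeriv_quasiPoly (p : ℂ[X]) (l : ℂ) (j : ℕ) :
    iteratedDeriv j (quasiPoly p l) = quasiPoly ((twist l)^[j] p) l := by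
  induction j with
  | zero => simp
  | succ j ih => rw [iteratedDeriv_succ, ih, deriv_quasiPoly, Function.iterate_succ_apply']

theorem natDegree_twist_le {l : ℂ} {p : ℂ[X]} {n : ℕ} (hp : p.natDegree ≤ n) :
    (twist l p).natDegree ≤ n :=
  natDegree_add_le_of_degree_le ((natDegree_derivative_le p).trans (by omega))
    ((natDegree_C_mul_le _ _).trans hp)

theorem natDegree_iterate_twist_le {l : ℂ} {p : ℂ[X]} {n : ℕ} (hp : p.natDegree ≤ n) (j : ℕ) :
    ((twist l)^[j] p).natDegree ≤ n := by
  induction j with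
  | zero => simpa using hp
  | succ j ih => rw [Function.iterate_succ_apply']; exact natDegree_twist_le ih

theorem coeff_iterate_twist {l : ℂ} {p : ℂ[X]} {n : ℕ} (hp : p.natDegree ≤ n) (j : ℕ) :
    ((twist l)^[j] p).coeff n = l ^ j * p.coeff n := by
  induction j with
  | zero => simp
  | succ j ih =>
    have h := natDegree_iterate_twist_le (l := l) hp j
    rw [Function.iterate_succ_apply', twist, coeff_add, coeff_C_mul, ih, coeff_derivative,
      coeff_eq_zero_of_natDegree_lt (by omega)]
    ring

/-- The correction term comes from the first derivative of `p` in the binomial expansion. Its factor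
`j * l ^ (j - 1)` is the derivative of `l ^ j`, whence the derivative of a polynomial in
`coeffFun_transpose_residue`. -/
theorem coeff_X_mul_iterate_twist {l : ℂ} {p : ℂ[X]} {n : ℕ} (hp : p.natDegree ≤ n) (j : ℕ) :
    (X * (twist l)^[j] p).coeff n =
      l ^ j * (X * p).coeff n + j * l ^ (j - 1) * n * p.coeff n := by
  induction j with
  | zero => simp
  | succ j ih =>
    have h1 : (X * derivative ((twist l)^[j] p)).coeff n = n * (l ^ j * p.coeff n) := by
      rw [← coeff_iterate_twist hp j]
      cases n with
      | zero => simp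
      | succ n => rw [coeff_X_mul, coeff_derivative]; push_cast; ring
    rw [Function.iterate_succ_apply', twist, mul_add, coeff_add, h1, mul_left_comm X (C l),
      coeff_C_mul, ih]
    have h4 : l * (j * l ^ (j - 1)) = j * l ^ j := by
      rcases j with (_ | j)
      · simp
      · simp only [Nat.add_sub_cancel, pow_succ]; ring
    rw [Nat.add_sub_cancel, pow_succ]
    push_cast
    linear_combination (n : ℂ) * p.coeff n * h4

theorem natDegree_prod_le_sum {ι : Type*} (s : Finset ι) {f : ι → ℂ[X]} {n : ι → ℕ}
    (hf : ∀ i, (f i).natDegree ≤ n i) : (∏ i ∈ s, f i).natDegree ≤ ∑ i ∈ s, n i :=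
  (natDegree_prod_le s f).trans (Finset.sum_le_sum fun i _ => hf i)

theorem coeff_prod_sum {ι : Type*} (s : Finset ι) {f : ι → ℂ[X]} {n : ι → ℕ}
    (hf : ∀ i, (f i).natDegree ≤ n i) :
    (∏ i ∈ s, f i).coeff (∑ i ∈ s, n i) = ∏ i ∈ s, (f i).coeff (n i) := by
  classical
  induction s using Finset.induction_on with
  | empty => simp
  | insert a s ha ih =>
    rw [Finset.prod_insert ha, Finset.prod_insert ha, Finset.sum_insert ha,
      coeff_mul_add_eq_of_natDegree_le (hf a) (natDegree_prod_le_sum s hf), ih]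

theorem natDegree_det_le {N : ℕ} {A : Matrix (Fin N) (Fin N) ℂ[X]} {n : Fin N → ℕ}
    (hA : ∀ i j, (A i j).natDegree ≤ n i) : A.det.natDegree ≤ ∑ i, n i := by
  -- After transposition the products in the determinant run over the rows, which carry the degree
  -- bounds.
  rw [← Matrix.det_transpose, Matrix.det_apply]
  refine natDegree_sum_le_of_forall_le _ _ fun σ _ => ?_
  refine (natDegree_smul_le _ _).trans ?_
  exact natDegree_prod_le_sum _ fun i => hA i _

theorem coeff_det_sum {N : ℕ} {A : Matrix (Fin N) (Fin N) ℂ[X]} {n : Fin N → ℕ}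
    (hA : ∀ i j, (A i j).natDegree ≤ n i) :
    A.det.coeff (∑ i, n i) = (Matrix.of fun i j => (A i j).coeff (n i)).det := by
  rw [← Matrix.det_transpose, Matrix.det_apply, finsetSum_coeff,
    ← Matrix.det_transpose (Matrix.of _), Matrix.det_apply]
  refine Finset.sum_congr rfl fun σ _ => ?_
  rw [coeff_smul]
  congr 1
  exact coeff_prod_sum _ fun i => hA i _

/-- The polynomial factor of the generalized Wronskian, with derivatives of orders `e`, of a family
of quasi-polynomials. -/
noncomputable def polyWronskian {N : ℕ} (p : Fin N → ℂ[X]) (lam : Fin N → ℂ) (e : Fin N → ℕ) :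
    ℂ[X] :=
  (Matrix.of fun i j => (twist (lam i))^[e j] (p i)).det

theorem det_iteratedDeriv_quasiPoly {N : ℕ} (p : Fin N → ℂ[X]) (lam : Fin N → ℂ)
    (e : Fin N → ℕ) (x : ℂ) :
    (Matrix.of fun i j => iteratedDeriv (e j) (quasiPoly (p i) (lam i)) x).det =
      Complex.exp ((∑ i, lam i) * x) * (polyWronskian p lam e).eval x := by
  have h1 : (Matrix.of fun i j => iteratedDeriv (e j) (quasiPoly (p i) (lam i)) x) =
      Matrix.of fun i j => Complex.exp (lam i * x) *
        ((evalRingHom x).mapMatrix (Matrix.of fun i j => (twist (lam i))^[e j] (p i))) i j := by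
    ext i j
    simp [iteratedDeriv_quasiPoly, quasiPoly, mul_comm]
  rw [h1, Matrix.det_mul_column, ← RingHom.map_det, ← Complex.exp_sum, Finset.sum_mul]
  rfl

theorem natDegree_polyWronskian_le {N : ℕ} {p : Fin N → ℂ[X]} {lam : Fin N → ℂ} {n : Fin N → ℕ}
    (hp : ∀ i, (p i).degree = n i) (e : Fin N → ℕ) :
    (polyWronskian p lam e).natDegree ≤ ∑ i, n i :=
  natDegree_det_le fun i _ => natDegree_iterate_twist_le (natDegree_le_of_degree_le (hp i).le) _

/-- Each twist multiplies the top coefficient by `lam i`, so this coefficient is the product of the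
leading coefficients of the `p i` and the Vandermonde determinant of `lam`. -/
theorem coeff_polyWronskian_ne_zero {N : ℕ} {p : Fin N → ℂ[X]} {lam : Fin N → ℂ} {n : Fin N → ℕ}
    (hp : ∀ i, (p i).degree = n i) (hlam : Function.Injective lam) :
    (polyWronskian p lam (fun j => (j : ℕ))).coeff (∑ i, n i) ≠ 0 := by
  have hd : ∀ i, (p i).natDegree ≤ n i := fun i => natDegree_le_of_degree_le (hp i).le
  rw [polyWronskian, coeff_det_sum (n := n) fun i j => by
    simpa using natDegree_iterate_twist_le (l := lam i) (hd i) (j : ℕ)]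
  have h1 : (Matrix.of fun i j : Fin N =>
      ((Matrix.of fun i j : Fin N => (twist (lam i))^[(j : ℕ)] (p i)) i j).coeff (n i)) =
      Matrix.of fun i j => (p i).coeff (n i) * Matrix.vandermonde lam i j := by
    ext i j
    simp [coeff_iterate_twist (hd i), Matrix.vandermonde_apply, mul_comm]
  rw [h1, Matrix.det_mul_column]
  exact mul_ne_zero (Finset.prod_ne_zero_iff.2 fun i _ => coeff_ne_zero_of_eq_degree (hp i))
    (Matrix.det_vandermonde_ne_zero_iff.2 hlam)

theorem pow_dvd_of_vanishesTo {p : ℂ[X]} {x : ℂ} {s : ℕ}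
    (h : VanishesTo (fun y => p.eval y) x s) : (X - C x) ^ s ∣ p := by
  by_cases hp : p = 0
  · simp [hp]
  rw [← le_rootMultiplicity_iff hp]
  by_contra! hlt
  obtain ⟨q, hq, hqx⟩ := exists_eq_pow_rootMultiplicity_mul_and_not_dvd p hp x
  set r := rootMultiplicity x p
  obtain ⟨g, hg, hpg⟩ := h
  apply hqx
  rw [dvd_iff_isRoot]
  have := mul_pow_cancel (x := x) (s := r) (f := fun y => q.eval y)
    (g := fun y => (y - x) ^ (s - r) * g y) q.continuous (by have := hg.continuous; fun_prop)
    (fun y => by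
      rw [← mul_assoc, ← pow_add, Nat.add_sub_cancel' hlt.le, ← hpg]
      conv_rhs => rw [hq]
      simp) x
  simpa [Nat.sub_ne_zero_of_lt hlt] using this

theorem rootMultiplicity_of_hasZeroOfOrder {p : ℂ[X]} {x : ℂ} {s : ℕ} (hp : p ≠ 0)
    (h : HasZeroOfOrder (fun y => p.eval y) x s) : rootMultiplicity x p = s := by
  refine le_antisymm ?_ ((le_rootMultiplicity_iff hp).2 (pow_dvd_of_vanishesTo h.vanishesTo))
  by_contra! hlt
  obtain ⟨q, hq⟩ := (le_rootMultiplicity_iff hp).1 (Nat.succ_le_of_lt hlt)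
  obtain ⟨g, hg, hgx, hpg⟩ := h
  apply hgx
  have := mul_pow_cancel (x := x) (s := s) (f := g)
    (g := fun y => (y - x) * q.eval y) hg.continuous (by have := q.continuous; fun_prop)
    (fun y => by rw [← hpg, hq]; simp [pow_succ, mul_assoc]) x
  simpa using this

/-! ### Families adapted to a point -/

/-- The family `G` consists of functions of orders `0, …, K - 1, K + μ` at `x`. -/
structure IsAdapted {K : ℕ} (G : Fin (K + 1) → ℂ → ℂ) (x : ℂ) (μ : ℕ) : Prop where
  castSucc : ∀ i : Fin K, HasZeroOfOrder (G i.castSucc) x i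
  last : HasZeroOfOrder (G (Fin.last K)) x (K + μ)

theorem exists_isAdapted {K μ : ℕ} {V : Submodule ℂ (ℂ → ℂ)}
    (hV : ∀ f ∈ V, Differentiable ℂ f) {x : ℂ}
    (hx : exponents V x = insert (((K + 1 : ℕ) : ℤ) - 1 + μ) (Set.Icc 0 (((K + 1 : ℕ) : ℤ) - 2))) :
    ∃ G : Fin (K + 1) → ℂ → ℂ, (∀ i, G i ∈ V) ∧ IsAdapted G x μ := by
  have h : ∀ s : ℕ, s < K ∨ s = K + μ → ∃ f ∈ V, HasZeroOfOrder f x s := by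
    intro s hs
    have : (s : ℤ) ∈ exponents V x := by
      rw [hx]
      simp only [Set.mem_insert_iff, Set.mem_Icc]
      omega
    obtain ⟨f, hf, t, ht, hft⟩ := (mem_exponents_iff hV x _).1 this
    obtain rfl : s = t := by exact_mod_cast ht
    exact ⟨f, hf, hft⟩
  choose f hfV hf using fun i : Fin K => h i (Or.inl i.2)
  obtain ⟨g, hgV, hg⟩ := h (K + μ) (Or.inr rfl)
  refine ⟨Fin.snoc (α := fun _ => ℂ → ℂ) f g, fun i => ?_, fun i => ?_, ?_⟩
  · induction i using Fin.lastCases with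
    | last => simpa using hgV
    | cast i => simpa using hfV i
  · simpa using hf i
  · simpa using hg

theorem IsAdapted.differentiable {K μ : ℕ} {G : Fin (K + 1) → ℂ → ℂ} {x : ℂ}
    (hG : IsAdapted G x μ) (i : Fin (K + 1)) : Differentiable ℂ (G i) := by
  induction i using Fin.lastCases with
  | last => exact hG.last.differentiable
  | cast i => exact (hG.castSucc i).differentiable

theorem vanishesTo_det {K s : ℕ} {x : ℂ} {A : ℂ → Matrix (Fin (K + 1)) (Fin (K + 1)) ℂ}
    (hA : ∀ i j, Differentiable ℂ fun y => A y i j)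
    (hlast : ∀ j, VanishesTo (fun y => A y (Fin.last K) j) x s) :
    VanishesTo (fun y => (A y).det) x s := by
  have h1 : (fun y => (A y).det) = fun y => ∑ j : Fin (K + 1), A y (Fin.last K) j *
      ((-1) ^ (K + (j : ℕ)) *
        ((A y).submatrix (Fin.last K).succAbove j.succAbove).det) := by
    ext y
    rw [Matrix.det_succ_row _ (Fin.last K)]
    exact Finset.sum_congr rfl fun j _ => by rw [Fin.val_last]; ring
  rw [h1]
  refine VanishesTo.sum fun j _ => (hlast j).mul_right ?_
  exact (differentiable_det fun _ _ => hA _ _).const_mul _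

/-- At `x` the matrix is triangular, and its diagonal entries, the `i`-th derivatives of functions
of order `i`, are nonzero. -/
theorem IsAdapted.wronskian_castSucc_ne_zero {K μ : ℕ} {G : Fin (K + 1) → ℂ → ℂ} {x : ℂ}
    (hG : IsAdapted G x μ) : wronskian (fun i : Fin K => G i.castSucc) x ≠ 0 := by
  rw [wronskian_eq_det_jets, Matrix.det_of_isUpperTriangular]
  · refine Finset.prod_ne_zero_iff.2 fun i _ => ?_
    have := (hG.castSucc i).iteratedDeriv (i := i) le_rfl
    rw [Nat.sub_self] at this
    exact this.apply_ne_zero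
  · intro i j hij
    have hij' : (j : ℕ) < i := hij
    exact ((hG.castSucc i).vanishesTo.iteratedDeriv hij'.le).apply_eq_zero (by omega)

/-- In the expansion along the last row, derivatives of order below `K` vanish beyond order `μ`. The
`K`-th derivative has order exactly `μ`, and its cofactor is nonzero at `x`. -/
theorem IsAdapted.hasZeroOfOrder_wronskian {K μ : ℕ} {G : Fin (K + 1) → ℂ → ℂ} {x : ℂ}
    (hG : IsAdapted G x μ) : HasZeroOfOrder (wronskian G) x μ := by
  have hd := fun i => hG.differentiable i
  have h1 : VanishesTo (fun y => ∑ j : Fin K, iteratedDeriv (j : ℕ) (G (Fin.last K)) y *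
      ((-1) ^ (K + (j : ℕ)) * ((jets G (K + 1) y).submatrix (Fin.last K).succAbove
        j.castSucc.succAbove).det)) x (μ + 1) := by
    refine VanishesTo.sum fun j _ => VanishesTo.mul_right ?_ ?_
    · exact (hG.last.vanishesTo.iteratedDeriv (by omega)).mono (by omega)
    · exact (differentiable_det fun _ _ => differentiable_iteratedDeriv (hd _) _).const_mul _
  obtain ⟨g, hg, hgy⟩ := h1
  obtain ⟨k, hk, hkx, hky⟩ := hG.last.iteratedDeriv (i := K) (by omega)
  rw [Nat.add_sub_cancel_left] at hky
  have hw := differentiable_wronskian fun i : Fin K => hd i.castSucc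
  refine ⟨fun y => k y * wronskian (fun i : Fin K => G i.castSucc) y + (y - x) * g y,
    by fun_prop, ?_, fun y => ?_⟩
  · simpa using ⟨hkx, hG.wronskian_castSucc_ne_zero⟩
  · have h2 : ((jets G (K + 1) y).submatrix (Fin.last K).succAbove (Fin.last K).succAbove) =
        jets (fun i : Fin K => G i.castSucc) K y := by
      ext i j; simp [jets]
    have h3 := hgy y
    beta_reduce at h3
    have h4 : ∀ j, jets G (K + 1) y (Fin.last K) j =
      iteratedDeriv (j : ℕ) (G (Fin.last K)) y := fun j => rfl
    rw [wronskian_eq_det_jets, Matrix.det_succ_row _ (Fin.last K), Fin.sum_univ_castSucc, h2,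
      ← wronskian_eq_det_jets]
    have h5 : ∀ j : Fin K, (-1 : ℂ) ^ (((Fin.last K : Fin (K + 1)) : ℕ) + (j.castSucc : ℕ)) *
        jets G (K + 1) y (Fin.last K) j.castSucc * ((jets G (K + 1) y).submatrix
          (Fin.last K).succAbove j.castSucc.succAbove).det =
        iteratedDeriv (j : ℕ) (G (Fin.last K)) y *
        ((-1) ^ (K + (j : ℕ)) * ((jets G (K + 1) y).submatrix (Fin.last K).succAbove
        j.castSucc.succAbove).det) := by
      intro j
      rw [h4, Fin.val_last, Fin.val_castSucc]; ring
    rw [Finset.sum_congr rfl fun j _ => h5 j, h3, h4, Fin.val_last, hky, ← two_mul, pow_mul]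
    simp only [even_two, Even.neg_pow, one_pow, one_mul, pow_succ]
    ring

/-- Only derivatives of order at most `K - 1` of the function of order `K + μ` occur. The gain of
one over the full Wronskian will cancel the simple pole of the integrand. -/
theorem IsAdapted.vanishesTo_wronskian_succAbove {K μ : ℕ} {G : Fin (K + 1) → ℂ → ℂ} {x : ℂ}
    (hG : IsAdapted G x μ) (k : Fin K) :
    VanishesTo (wronskian fun i : Fin K => G (k.castSucc.succAbove i)) x (μ + 1) := by
  cases K with
  | zero => exact k.elim0
  | succ K =>
    refine vanishesTo_det (fun _ _ => differentiable_iteratedDeriv (hG.differentiable _) _)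
      fun j => ?_
    have h1 : k.castSucc.succAbove (Fin.last K) = Fin.last (K + 1) := by
      rw [Fin.succAbove_of_le_castSucc]
      · simp
      · exact Fin.castSucc_le_castSucc_iff.2 (Fin.le_last k)
    simp only [Matrix.of_apply, h1]
    exact (hG.last.vanishesTo.iteratedDeriv (by omega)).mono (by omega)

theorem IsAdapted.vanishesTo_det_iteratedDeriv {K μ : ℕ} {G : Fin (K + 1) → ℂ → ℂ} {x : ℂ}
    (hG : IsAdapted G x μ) {e : Fin (K + 1) → ℕ} (he : ∀ j, e j ≤ K + 1) :
    VanishesTo (fun y => (Matrix.of fun i j => iteratedDeriv (e j) (G i) y).det) x (μ - 1) := by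
  refine vanishesTo_det (fun _ _ => differentiable_iteratedDeriv (hG.differentiable _) _)
    fun j => ?_
  have := he j
  -- For `μ = 0` the truncated exponent is zero and nothing has to vanish, although derivatives of
  -- order `K + 1` exceed the order of the function.
  rcases Nat.eq_zero_or_pos μ with rfl | hμ
  · exact ⟨iteratedDeriv (e j) (G (Fin.last K)),
      differentiable_iteratedDeriv (hG.differentiable _) _, fun y => by simp⟩
  · exact (hG.last.vanishesTo.iteratedDeriv (by omega)).mono (by omega)

theorem VanishesTo.const_exp_cancel {f : ℂ → ℂ} {x : ℂ} {s : ℕ} {d l : ℂ} (hd : d ≠ 0)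
    (h : VanishesTo (fun y => d * (Complex.exp (l * y) * f y)) x s) : VanishesTo f x s := by
  obtain ⟨g, hg, hfg⟩ := h
  refine ⟨fun y => d⁻¹ * Complex.exp (-(l * y)) * g y, by fun_prop, fun y => ?_⟩
  have h1 := hfg y
  have h2 : Complex.exp (-(l * y)) * Complex.exp (l * y) = 1 := by
    rw [← Complex.exp_add]; simp
  have h3 : d⁻¹ * d = 1 := inv_mul_cancel₀ hd
  calc f y = (d⁻¹ * d) * (Complex.exp (-(l * y)) * Complex.exp (l * y)) * f y := by
        rw [h2, h3]; ring
    _ = _ := by linear_combination d⁻¹ * Complex.exp (-(l * y)) * h1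

theorem HasZeroOfOrder.const_exp_cancel {f : ℂ → ℂ} {x : ℂ} {s : ℕ} {d l : ℂ} (hd : d ≠ 0)
    (h : HasZeroOfOrder (fun y => d * (Complex.exp (l * y) * f y)) x s) :
    HasZeroOfOrder f x s := by
  obtain ⟨g, hg, hgx, hfg⟩ := h
  refine ⟨fun y => d⁻¹ * Complex.exp (-(l * y)) * g y, by fun_prop, by simp [hd, hgx],
    fun y => ?_⟩
  have h1 := hfg y
  have h2 : Complex.exp (-(l * y)) * Complex.exp (l * y) = 1 := by
    rw [← Complex.exp_add]; simp
  have h3 : d⁻¹ * d = 1 := inv_mul_cancel₀ hd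
  calc f y = (d⁻¹ * d) * (Complex.exp (-(l * y)) * Complex.exp (l * y)) * f y := by
        rw [h2, h3]; ring
    _ = _ := by linear_combination d⁻¹ * Complex.exp (-(l * y)) * h1

/-! ### Spaces of quasi-polynomials and special spaces -/

/-- The span of the quasi-polynomials `p i (x) exp (lam i x)`. -/
noncomputable def quasiSpan {N : ℕ} (p : Fin N → ℂ[X]) (lam : Fin N → ℂ) : Submodule ℂ (ℂ → ℂ) :=
  Submodule.span ℂ (Set.range fun i => quasiPoly (p i) (lam i))

theorem differentiable_of_mem_quasiSpan {N : ℕ} {p : Fin N → ℂ[X]} {lam : Fin N → ℂ} :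
    ∀ f ∈ quasiSpan p lam, Differentiable ℂ f := by
  intro f hf
  obtain ⟨c, rfl⟩ := (Submodule.mem_span_range_iff_exists_fun ℂ).1 hf
  exact Differentiable.sum fun i _ => (differentiable_quasiPoly _ _).const_smul _

/-- The constant is the determinant of the coefficient matrix, hence the same for all orders of
derivatives and all points. -/
theorem det_iteratedDeriv_eq_of_mem {N : ℕ} {p : Fin N → ℂ[X]} {lam : Fin N → ℂ}
    {G : Fin N → ℂ → ℂ} (hG : ∀ i, G i ∈ quasiSpan p lam) :
    ∃ d : ℂ, ∀ (e : Fin N → ℕ) (y : ℂ), (Matrix.of fun i j => iteratedDeriv (e j) (G i) y).det =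
      d * (Complex.exp ((∑ i, lam i) * y) * (polyWronskian p lam e).eval y) := by
  choose T hT using fun i => (Submodule.mem_span_range_iff_exists_fun ℂ).1 (hG i)
  refine ⟨(Matrix.of T).det, fun e y => ?_⟩
  rw [← det_iteratedDeriv_quasiPoly, ← Matrix.det_mul]
  congr 1
  ext i j
  simp only [Matrix.of_apply, Matrix.mul_apply, ← hT]
  exact iteratedDeriv_sum_smul (fun _ => differentiable_quasiPoly _ _) _ _ _

theorem polyWronskian_ne_zero {N : ℕ} {p : Fin N → ℂ[X]} {lam : Fin N → ℂ} {n : Fin N → ℕ}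
    (hp : ∀ i, (p i).degree = n i) (hlam : Function.Injective lam) :
    polyWronskian p lam (fun j => (j : ℕ)) ≠ 0 := by
  intro h
  have := coeff_polyWronskian_ne_zero hp hlam
  rw [h] at this
  simp at this

theorem linearIndependent_quasiPoly {N : ℕ} {p : Fin N → ℂ[X]} {lam : Fin N → ℂ} {n : Fin N → ℕ}
    (hp : ∀ i, (p i).degree = n i) (hlam : Function.Injective lam) :
    LinearIndependent ℂ fun i => quasiPoly (p i) (lam i) := by
  obtain ⟨x, hx⟩ : ∃ x, (polyWronskian p lam (fun j => (j : ℕ))).eval x ≠ 0 := by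
    by_contra! h
    exact polyWronskian_ne_zero hp hlam (Polynomial.funext fun x => by simpa using h x)
  refine linearIndependent_of_wronskian_ne_zero (x := x) (fun _ => differentiable_quasiPoly _ _) ?_
  have := det_iteratedDeriv_quasiPoly p lam (fun j => (j : ℕ)) x
  rw [wronskian, this]
  exact mul_ne_zero (Complex.exp_ne_zero _) hx

theorem finrank_quasiSpan {N : ℕ} {p : Fin N → ℂ[X]} {lam : Fin N → ℂ} {n : Fin N → ℕ}
    (hp : ∀ i, (p i).degree = n i) (hlam : Function.Injective lam) :
    Module.finrank ℂ (quasiSpan p lam) = N := by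
  rw [quasiSpan, finrank_span_eq_card (linearIndependent_quasiPoly hp hlam), Fintype.card_fin]

section Adapted

variable {K μ : ℕ} {p : Fin (K + 1) → ℂ[X]} {lam : Fin (K + 1) → ℂ} {n : Fin (K + 1) → ℕ}
  {G : Fin (K + 1) → ℂ → ℂ} {x : ℂ}

/-- The constant cannot vanish, because the Wronskian of an adapted family has finite order at `x`.
-/
theorem exists_wronskian_eq_of_isAdapted (hG : IsAdapted G x μ)
    (hGV : ∀ i, G i ∈ quasiSpan p lam) :
    ∃ d : ℂ, d ≠ 0 ∧ ∀ (e : Fin (K + 1) → ℕ) (y : ℂ),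
      (Matrix.of fun i j => iteratedDeriv (e j) (G i) y).det =
        d * (Complex.exp ((∑ i, lam i) * y) * (polyWronskian p lam e).eval y) := by
  obtain ⟨d, hd⟩ := det_iteratedDeriv_eq_of_mem hGV
  refine ⟨d, ?_, hd⟩
  rintro rfl
  obtain ⟨h, -, hx, -⟩ := hG.hasZeroOfOrder_wronskian
  have hW : wronskian G = fun _ => 0 := by
    ext y
    have := hd (fun j => (j : ℕ)) y
    rw [zero_mul] at this
    exact this
  have h1 := hG.hasZeroOfOrder_wronskian.meromorphicOrderAt_eq
  rw [hW, meromorphicOrderAt_eq_top_iff.2 (by simp)] at h1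
  exact absurd h1 (by simp)

theorem rootMultiplicity_polyWronskian (hp : ∀ i, (p i).degree = n i)
    (hlam : Function.Injective lam) (hG : IsAdapted G x μ) (hGV : ∀ i, G i ∈ quasiSpan p lam) :
    rootMultiplicity x (polyWronskian p lam (fun j => (j : ℕ))) = μ := by
  obtain ⟨d, hd0, hd⟩ := exists_wronskian_eq_of_isAdapted hG hGV
  refine rootMultiplicity_of_hasZeroOfOrder (polyWronskian_ne_zero hp hlam)
    (HasZeroOfOrder.const_exp_cancel (l := ∑ i, lam i) hd0 ?_)
  have : wronskian G = _ := funext fun y => hd (fun j => (j : ℕ)) y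
  rw [← this]
  exact hG.hasZeroOfOrder_wronskian

theorem pow_dvd_polyWronskian (hG : IsAdapted G x μ) (hGV : ∀ i, G i ∈ quasiSpan p lam)
    {e : Fin (K + 1) → ℕ} (he : ∀ j, e j ≤ K + 1) :
    (X - C x) ^ (μ - 1) ∣ polyWronskian p lam e := by
  obtain ⟨d, hd0, hd⟩ := exists_wronskian_eq_of_isAdapted hG hGV
  refine pow_dvd_of_vanishesTo (VanishesTo.const_exp_cancel (l := ∑ i, lam i) hd0 ?_)
  rw [← funext fun y => hd e y]
  exact hG.vanishesTo_det_iteratedDeriv he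

end Adapted

/-- A special space has exponents `0, …, K - 1, K + μ` at every point, with `μ = 0` off the marked
points. -/
theorem IsSpecialSpace.exponents_eq_at {K M : ℕ} {lam : Fin (K + 1) → ℂ} {z : Fin M → ℂ}
    {n : Fin (K + 1) → ℕ} {m : Fin M → ℕ} {V : Submodule ℂ (ℂ → ℂ)}
    (hV : IsSpecialSpace lam z n m V) (x : ℂ) :
    ∃ μ : ℕ, (x ∉ Set.range z → μ = 0) ∧ (∀ a, x = z a → μ = m a) ∧
      exponents V x =
        insert (((K + 1 : ℕ) : ℤ) - 1 + μ) (Set.Icc 0 (((K + 1 : ℕ) : ℤ) - 2)) := by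
  by_cases hx : x ∈ Set.range z
  · obtain ⟨a, rfl⟩ := hx
    exact ⟨m a, fun h => absurd ⟨a, rfl⟩ h, fun b hb => by rw [hV.z_injective hb],
      hV.exponents_eq a⟩
  · refine ⟨0, fun _ => rfl, fun a ha => absurd ⟨a, ha.symm⟩ hx, ?_⟩
    have h1 : ¬ IsSingularPoint (K + 1) V x := fun h => hx (hV.singular x h)
    rw [IsSingularPoint, not_not] at h1
    rw [h1]
    ext e
    simp only [Set.mem_insert_iff, Set.mem_Icc, Set.mem_Ico]
    omega

theorem IsSpecialSpace.exists_quasiSpan {N M : ℕ} {lam : Fin N → ℂ} {z : Fin M → ℂ}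
    {n : Fin N → ℕ} {m : Fin M → ℕ} {V : Submodule ℂ (ℂ → ℂ)}
    (hV : IsSpecialSpace lam z n m V) :
    ∃ p : Fin N → ℂ[X], (∀ i, (p i).degree = n i) ∧ V = quasiSpan p lam :=
  hV.exists_span

theorem IsSpecialSpace.differentiable {N M : ℕ} {lam : Fin N → ℂ} {z : Fin M → ℂ}
    {n : Fin N → ℕ} {m : Fin M → ℕ} {V : Submodule ℂ (ℂ → ℂ)}
    (hV : IsSpecialSpace lam z n m V) : ∀ f ∈ V, Differentiable ℂ f := by
  obtain ⟨p, -, rfl⟩ := hV.exists_quasiSpan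
  exact differentiable_of_mem_quasiSpan

theorem IsSpecialSpace.finrank_eq {N M : ℕ} {lam : Fin N → ℂ} {z : Fin M → ℂ}
    {n : Fin N → ℕ} {m : Fin M → ℕ} {V : Submodule ℂ (ℂ → ℂ)}
    (hV : IsSpecialSpace lam z n m V) : Module.finrank ℂ V = N := by
  obtain ⟨p, hp, rfl⟩ := hV.exists_quasiSpan
  exact finrank_quasiSpan hp hV.lam_injective

theorem IsSpecialSpace.exists_isAdapted {K M : ℕ} {lam : Fin (K + 1) → ℂ} {z : Fin M → ℂ}
    {n : Fin (K + 1) → ℕ} {m : Fin M → ℕ} {V : Submodule ℂ (ℂ → ℂ)}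
    (hV : IsSpecialSpace lam z n m V) (x : ℂ) :
    ∃ μ : ℕ, (x ∉ Set.range z → μ = 0) ∧ (∀ a, x = z a → μ = m a) ∧
      ∃ G : Fin (K + 1) → ℂ → ℂ, (∀ i, G i ∈ V) ∧ IsAdapted G x μ := by
  obtain ⟨μ, h1, h2, h3⟩ := hV.exponents_eq_at x
  exact ⟨μ, h1, h2, SpecialSpaces.exists_isAdapted hV.differentiable h3⟩

/-- The coefficient functions of the operator `∑ A i j x^i (d/dx)^j`. -/
def coeffFun {N M : ℕ} (A : Matrix (Fin (M + 1)) (Fin (N + 1)) ℂ) (j : Fin (N + 1)) (x : ℂ) : ℂ :=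
  ∑ i, A i j * x ^ (i : ℕ)

/-- Root multiplicities are compared point by point: `μ` on the left, at least `μ - 1` for the
generalized Wronskian. The missing unit is the factor `X - C (z a)`, as `μ > 0` only at marked
points. -/
theorem polyWronskian_dvd {K M : ℕ} {lam : Fin (K + 1) → ℂ} {z : Fin M → ℂ}
    {n : Fin (K + 1) → ℕ} {m : Fin M → ℕ} {p : Fin (K + 1) → ℂ[X]} (hp : ∀ i, (p i).degree = n i)
    (hV : IsSpecialSpace lam z n m (quasiSpan p lam)) {e : Fin (K + 1) → ℕ}
    (he : ∀ j, e j ≤ K + 1) :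
    polyWronskian p lam (fun j => (j : ℕ)) ∣ (∏ a, (X - C (z a))) * polyWronskian p lam e := by
  by_cases h0 : polyWronskian p lam e = 0
  · simp [h0]
  have hP := polyWronskian_ne_zero hp hV.lam_injective
  have hQ : (∏ a, (X - C (z a))) * polyWronskian p lam e ≠ 0 :=
    mul_ne_zero (Finset.prod_ne_zero_iff.2 fun a _ => X_sub_C_ne_zero _) h0
  rw [IsAlgClosed.dvd_iff_roots_le_roots hP hQ, Multiset.le_iff_count]
  intro x
  rw [count_roots, count_roots]
  obtain ⟨μ, h1, h2, G, hGV, hG⟩ := hV.exists_isAdapted x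
  rw [rootMultiplicity_polyWronskian hp hV.lam_injective hG hGV, le_rootMultiplicity_iff hQ]
  rcases Nat.eq_zero_or_pos μ with rfl | hμ
  · simp
  have hx : x ∈ Set.range z := by
    by_contra hx
    exact hμ.ne' (h1 hx)
  obtain ⟨a, rfl⟩ := hx
  rw [show μ = 1 + (μ - 1) by omega, pow_add, pow_one]
  exact mul_dvd_mul (Finset.dvd_prod_of_mem (fun a => X - C (z a)) (Finset.mem_univ a))
    (pow_dvd_polyWronskian hG hGV he)

/-- Existence of the special fundamental operator. -/
theorem IsSpecialSpace.exists_operator {K M : ℕ} {lam : Fin (K + 1) → ℂ} {z : Fin M → ℂ}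
    {n : Fin (K + 1) → ℕ} {m : Fin M → ℕ} {V : Submodule ℂ (ℂ → ℂ)}
    (hV : IsSpecialSpace lam z n m V) :
    ∃ A : Matrix (Fin (M + 1)) (Fin (K + 1 + 1)) ℂ,
      (∀ x, coeffFun A (Fin.last _) x = ∏ a, (x - z a)) ∧ Annihilates (coeffFun A) V := by
  obtain ⟨p, hp, rfl⟩ := hV.exists_quasiSpan
  set P := polyWronskian p lam (fun j => (j : ℕ)) with hPdef
  set Q : ℂ[X] := ∏ a, (X - C (z a)) with hQdef
  have hP : P ≠ 0 := polyWronskian_ne_zero hp hV.lam_injective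
  have hQdeg : Q.natDegree = M := by
    rw [hQdef, natDegree_prod_of_monic _ _ fun a _ => monic_X_sub_C _]
    simp
  -- The numerators of Cramer's rule: the column of `j`-th derivatives is replaced by derivatives of
  -- order `K + 1`.
  let R : Fin (K + 1) → ℂ[X] := fun j =>
    polyWronskian p lam (Function.update (fun j => (j : ℕ)) j (K + 1))
  have hdvd : ∀ j, P ∣ Q * R j := fun j => polyWronskian_dvd hp hV fun i => by
    by_cases hi : i = j
    · subst hi; simp
    · rw [Function.update_of_ne hi]; omega
  choose S hS using hdvd
  -- The degree of `P` is at least `∑ i, n i`, that of `R j` at most this, so the quotient has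
  -- degree at most that of `Q`.
  have hSdeg : ∀ j, (S j).natDegree ≤ M := by
    intro j
    by_cases hSj : S j = 0
    · simp [hSj]
    have h1 := congrArg natDegree (hS j)
    rw [natDegree_mul hP hSj] at h1
    have h2 : (Q * R j).natDegree ≤ M + ∑ i, n i :=
      natDegree_mul_le.trans (add_le_add hQdeg.le (natDegree_polyWronskian_le hp _))
    have h3 : ∑ i, n i ≤ P.natDegree :=
      le_natDegree_of_ne_zero (coeff_polyWronskian_ne_zero hp hV.lam_injective)
    omega
  have hcramer : ∀ i, P * (twist (lam i))^[K + 1] (p i) =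
      ∑ j : Fin (K + 1), R j * (twist (lam i))^[(j : ℕ)] (p i) := by
    intro i
    have h1 := congrFun (Matrix.mulVec_cramer
      (Matrix.of fun i j : Fin (K + 1) => (twist (lam i))^[(j : ℕ)] (p i))
      (fun i => (twist (lam i))^[K + 1] (p i))) i
    rw [Pi.smul_apply, smul_eq_mul] at h1
    change _ = P * _ at h1
    rw [← h1, Matrix.mulVec, dotProduct]
    refine Finset.sum_congr rfl fun j _ => ?_
    rw [mul_comm, Matrix.cramer_apply]
    congr 1
    simp only [R, polyWronskian]
    congr 1
    ext i' j'
    by_cases hj : j' = j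
    · subst hj; simp
    · simp [hj]
  have hrel : ∀ i, Q * (twist (lam i))^[K + 1] (p i) =
      ∑ j : Fin (K + 1), S j * (twist (lam i))^[(j : ℕ)] (p i) := by
    intro i
    apply mul_left_cancel₀ hP
    calc _ = Q * (P * (twist (lam i))^[K + 1] (p i)) := by ring
      _ = _ := by
        rw [hcramer, Finset.mul_sum, Finset.mul_sum]
        exact Finset.sum_congr rfl fun j _ => by
          rw [← mul_assoc, hS, mul_assoc]
  let B : Fin (K + 1 + 1) → ℂ[X] := Fin.snoc (α := fun _ => ℂ[X]) (fun j => -S j) Q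
  have hBdeg : ∀ j, (B j).natDegree < M + 1 := by
    intro j
    induction j using Fin.lastCases with
    | last => simp [B, hQdeg]
    | cast j => simpa [B] using Nat.lt_succ_of_le (hSdeg j)
  have hBcoeff : ∀ j x, coeffFun (Matrix.of fun (i : Fin (M + 1)) j => (B j).coeff i) j x =
      (B j).eval x := by
    intro j x
    rw [eval_eq_sum_range' (hBdeg j), ← Fin.sum_univ_eq_sum_range fun i => (B j).coeff i * x ^ i]
    rfl
  refine ⟨Matrix.of fun i j => (B j).coeff i, fun x => ?_, ?_⟩
  · rw [hBcoeff]
    simp [B, hQdef, eval_prod]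
  · intro f hf x
    simp only [hBcoeff]
    obtain ⟨c, rfl⟩ := (Submodule.mem_span_range_iff_exists_fun ℂ).1 hf
    have h1 : ∀ i, ∑ j : Fin (K + 1 + 1), (B j).eval x *
        iteratedDeriv (j : ℕ) (quasiPoly (p i) (lam i)) x = 0 := by
      intro i
      simp only [iteratedDeriv_quasiPoly, quasiPoly, ← mul_assoc, ← Finset.sum_mul]
      refine mul_eq_zero_of_left ?_ _
      have h2 := congrArg (eval x) (hrel i)
      rw [eval_mul, eval_finsetSum] at h2
      simp only [eval_mul] at h2
      rw [Fin.sum_univ_castSucc]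
      simp only [B, Fin.snoc_castSucc, Fin.snoc_last, Fin.val_castSucc, Fin.val_last, eval_neg,
        neg_mul, Finset.sum_neg_distrib]
      rw [h2, neg_add_cancel]
    simp only [iteratedDeriv_sum_smul (fun i => differentiable_quasiPoly (p i) (lam i)),
      Finset.mul_sum]
    rw [Finset.sum_comm]
    refine Finset.sum_eq_zero fun i _ => ?_
    rw [← mul_zero (c i), ← h1 i, Finset.mul_sum]
    exact Finset.sum_congr rfl fun j _ => by ring

/-! ### The transposed operator and the dual exponents -/

theorem continuous_coeffFun {N M : ℕ} (A : Matrix (Fin (M + 1)) (Fin (N + 1)) ℂ)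
    (j : Fin (N + 1)) : Continuous (coeffFun A j) := by
  unfold coeffFun
  fun_prop

/-- The polynomial with the coefficients of a column of `A`. -/
noncomputable def colPoly {N M : ℕ} (A : Matrix (Fin (M + 1)) (Fin (N + 1)) ℂ)
    (j : Fin (N + 1)) : ℂ[X] :=
  ∑ i : Fin (M + 1), C (A i j) * X ^ (i : ℕ)

theorem eval_colPoly {N M : ℕ} (A : Matrix (Fin (M + 1)) (Fin (N + 1)) ℂ)
    (j : Fin (N + 1)) (x : ℂ) : (colPoly A j).eval x = coeffFun A j x := by
  simp [colPoly, coeffFun, eval_finsetSum]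

theorem coeff_colPoly {N M : ℕ} (A : Matrix (Fin (M + 1)) (Fin (N + 1)) ℂ)
    (j : Fin (N + 1)) (i : Fin (M + 1)) : (colPoly A j).coeff i = A i j := by
  simp only [colPoly, finsetSum_coeff, coeff_C_mul, coeff_X_pow]
  rw [Finset.sum_eq_single i]
  · simp
  · intro k _ hk
    simp [Fin.val_ne_of_ne hk.symm]
  · simp

theorem natDegree_colPoly_le {N M : ℕ} (A : Matrix (Fin (M + 1)) (Fin (N + 1)) ℂ)
    (j : Fin (N + 1)) : (colPoly A j).natDegree ≤ M :=
  natDegree_sum_le_of_forall_le _ _ fun i _ =>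
    (natDegree_C_mul_X_pow_le _ _).trans (Nat.le_of_lt_succ i.2)

theorem colPoly_eq_prod {N M : ℕ} {A : Matrix (Fin (M + 1)) (Fin (N + 1)) ℂ}
    {j : Fin (N + 1)} {z : Fin M → ℂ} (h : ∀ x, coeffFun A j x = ∏ a, (x - z a)) :
    colPoly A j = ∏ a, (X - C (z a)) := by
  refine Polynomial.funext fun x => ?_
  rw [eval_colPoly, h, eval_prod]
  simp

/-- The corner coefficient of an operator with leading coefficient `∏ (x - z a)`. -/
theorem apply_last_eq_one {N M : ℕ} {A : Matrix (Fin (M + 1)) (Fin (N + 1)) ℂ}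
    {j : Fin (N + 1)} {z : Fin M → ℂ} (h : ∀ x, coeffFun A j x = ∏ a, (x - z a)) :
    A (Fin.last M) j = 1 := by
  have h1 : (∏ a, (X - C (z a)) : ℂ[X]).Monic := monic_prod_of_monic _ _ fun a _ =>
    monic_X_sub_C _
  have h2 : (∏ a, (X - C (z a)) : ℂ[X]).natDegree = M := by
    rw [natDegree_prod_of_monic _ _ fun a _ => monic_X_sub_C _]; simp
  rw [← coeff_colPoly A, colPoly_eq_prod h, Fin.val_last]
  have h3 := h1.coeff_natDegree
  rwa [h2] at h3

section Bispectral

variable {K L : ℕ} {A : Matrix (Fin (L + 1 + 1)) (Fin (K + 1 + 1)) ℂ} {p : ℂ[X]} {l : ℂ} {n : ℕ}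

/-- The polynomial by which `x ^ i` is multiplied in the action of `∑ A i j x^i (d/dx)^j` on
`p(x) exp(l x)`. -/
noncomputable def rowTwist (A : Matrix (Fin (L + 1 + 1)) (Fin (K + 1 + 1)) ℂ) (p : ℂ[X]) (l : ℂ)
    (i : Fin (L + 1 + 1)) : ℂ[X] :=
  ∑ j : Fin (K + 1 + 1), C (A i j) * (twist l)^[(j : ℕ)] p

theorem sum_rowTwist_eq_zero
    (h : ∀ x, ∑ j, coeffFun A j x * iteratedDeriv (j : ℕ) (quasiPoly p l) x = 0) :
    ∑ i : Fin (L + 1 + 1), X ^ (i : ℕ) * rowTwist A p l i = 0 := by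
  refine Polynomial.funext fun x => ?_
  have h1 := h x
  simp only [iteratedDeriv_quasiPoly, quasiPoly, ← mul_assoc, ← Finset.sum_mul] at h1
  have h2 := (mul_eq_zero.1 h1).resolve_right (Complex.exp_ne_zero _)
  simp only [rowTwist, eval_finsetSum, eval_mul, eval_pow, eval_X, eval_C, eval_zero]
  rw [← h2]
  simp only [coeffFun, Finset.sum_mul, Finset.mul_sum]
  rw [Finset.sum_comm]
  exact Finset.sum_congr rfl fun j _ => Finset.sum_congr rfl fun i _ => by ring

theorem natDegree_rowTwist_le (hp : p.natDegree ≤ n) (i : Fin (L + 1 + 1)) :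
    (rowTwist A p l i).natDegree ≤ n :=
  natDegree_sum_le_of_forall_le _ _ fun _ _ =>
    (natDegree_C_mul_le _ _).trans (natDegree_iterate_twist_le hp _)

theorem coeff_rowTwist (hp : p.natDegree ≤ n) (i : Fin (L + 1 + 1)) :
    (rowTwist A p l i).coeff n = coeffFun A.transpose i l * p.coeff n := by
  simp only [rowTwist, finsetSum_coeff, coeff_C_mul, coeff_iterate_twist hp, coeffFun,
    Finset.sum_mul, Matrix.transpose_apply, mul_assoc]

/-- Only the row with the highest power of `x` reaches degree `n + L + 1`; its coefficient there is
the claimed value times the leading coefficient of `p`. -/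
theorem coeffFun_transpose_last_eq_zero (hp : p.degree = n)
    (h : ∀ x, ∑ j, coeffFun A j x * iteratedDeriv (j : ℕ) (quasiPoly p l) x = 0) :
    coeffFun A.transpose (Fin.last _) l = 0 := by
  have hd : p.natDegree ≤ n := natDegree_le_of_degree_le hp.le
  have h1 : ∑ i : Fin (L + 1 + 1), (X ^ (i : ℕ) * rowTwist A p l i).coeff (n + (L + 1)) = 0 := by
    rw [← finsetSum_coeff, sum_rowTwist_eq_zero h, coeff_zero]
  rw [Fin.sum_univ_castSucc, Finset.sum_eq_zero, zero_add, Fin.val_last, coeff_X_pow_mul,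
    coeff_rowTwist hd] at h1
  · exact (mul_eq_zero.1 h1).resolve_right (coeff_ne_zero_of_eq_degree hp)
  · intro i _
    have hi := i.2
    rw [Fin.val_castSucc, coeff_X_pow_mul', if_pos (by omega)]
    exact coeff_eq_zero_of_natDegree_lt ((natDegree_rowTwist_le hd _).trans_lt (by omega))

/-- The next power of `x` is compared. The relation is first multiplied by `X`, so that no
coefficient of index `n - 1` is needed when `n = 0`. -/
theorem coeffFun_transpose_residue (hp : p.degree = n)
    (h : ∀ x, ∑ j, coeffFun A j x * iteratedDeriv (j : ℕ) (quasiPoly p l) x = 0) :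
    coeffFun A.transpose (Fin.last L).castSucc l =
      -n * (derivative (colPoly A.transpose (Fin.last _))).eval l := by
  have hd : p.natDegree ≤ n := natDegree_le_of_degree_le hp.le
  have h0 := coeffFun_transpose_last_eq_zero hp h
  have h1 : ∑ i : Fin (L + 1 + 1),
      (X ^ (i : ℕ) * (X * rowTwist A p l i)).coeff (n + (L + 1)) = 0 := by
    simp only [mul_left_comm _ X]
    rw [← finsetSum_coeff, ← Finset.mul_sum, sum_rowTwist_eq_zero h, mul_zero, coeff_zero]
  rw [Fin.sum_univ_castSucc, Fin.sum_univ_castSucc, Finset.sum_eq_zero, zero_add,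
    Fin.val_last, Fin.val_castSucc, Fin.val_last, coeff_X_pow_mul, ← mul_assoc (X ^ L), ← pow_succ,
    coeff_X_pow_mul, coeff_rowTwist hd] at h1
  · have h2 : (X * rowTwist A p l (Fin.last (L + 1))).coeff n =
        coeffFun A.transpose (Fin.last _) l * (X * p).coeff n +
        n * (derivative (colPoly A.transpose (Fin.last _))).eval l * p.coeff n := by
      simp only [rowTwist, Finset.mul_sum, finsetSum_coeff, mul_left_comm X (C _), coeff_C_mul,
        coeff_X_mul_iterate_twist hd, coeffFun, colPoly, derivative_sum, derivative_C_mul,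
        derivative_X_pow, eval_finsetSum, eval_mul, eval_C, eval_pow, eval_X, Finset.sum_mul,
        ← Finset.sum_add_distrib, Matrix.transpose_apply]
      exact Finset.sum_congr rfl fun j _ => by ring
    rw [h2, h0] at h1
    have hc : p.coeff n ≠ 0 := coeff_ne_zero_of_eq_degree hp
    apply mul_right_cancel₀ hc
    linear_combination h1
  · intro i _
    have hi := i.2
    rw [Fin.val_castSucc, Fin.val_castSucc, ← mul_assoc, ← pow_succ, coeff_X_pow_mul',
      if_pos (by omega)]
    exact coeff_eq_zero_of_natDegree_lt ((natDegree_rowTwist_le hd _).trans_lt (by omega))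

end Bispectral

/-- The corner entry of `A` is `1`, so this polynomial is monic of degree `K + 1`, and it vanishes
at the `K + 1` distinct points `lam i`. -/
theorem coeffFun_transpose_last {K L : ℕ} {A : Matrix (Fin (L + 1 + 1)) (Fin (K + 1 + 1)) ℂ}
    {z : Fin (L + 1) → ℂ} {lam : Fin (K + 1) → ℂ}
    (hlead : ∀ x, coeffFun A (Fin.last _) x = ∏ a, (x - z a)) (hlam : Function.Injective lam)
    (h0 : ∀ i, coeffFun A.transpose (Fin.last _) (lam i) = 0) :
    colPoly A.transpose (Fin.last _) = ∏ i, (X - C (lam i)) := by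
  have hmon : (∏ i, (X - C (lam i)) : ℂ[X]).Monic := monic_prod_of_monic _ _ fun a _ =>
    monic_X_sub_C _
  have hdeg : (∏ i, (X - C (lam i)) : ℂ[X]).natDegree = K + 1 := by
    rw [natDegree_prod_of_monic _ _ fun a _ => monic_X_sub_C _]; simp
  have h1 : (colPoly A.transpose (Fin.last (L + 1))).coeff (K + 1) = 1 := by
    have := coeff_colPoly A.transpose (Fin.last (L + 1)) (Fin.last (K + 1))
    rw [Fin.val_last] at this
    rw [this, Matrix.transpose_apply, apply_last_eq_one hlead]
  have hle := natDegree_colPoly_le A.transpose (Fin.last (L + 1))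
  refine (eq_of_monic_of_dvd_of_natDegree_le hmon
    (monic_of_natDegree_le_of_coeff_eq_one _ hle h1) ?_ (hle.trans hdeg.ge))
  refine Finset.prod_dvd_of_coprime ((pairwise_coprime_X_sub_C hlam).set_pairwise _) fun i _ => ?_
  rw [dvd_iff_isRoot, IsRoot.def, eval_colPoly, h0]

/-- The dual exponents: a space of entire functions of full dimension annihilated by the transposed
operator has prescribed singular points and exponents. -/
theorem dual_exponents {K L : ℕ} {A : Matrix (Fin (L + 1 + 1)) (Fin (K + 1 + 1)) ℂ}
    {z : Fin (L + 1) → ℂ} {lam : Fin (K + 1) → ℂ} {n : Fin (K + 1) → ℕ} {p : Fin (K + 1) → ℂ[X]}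
    (hp : ∀ i, (p i).degree = n i) (hlam : Function.Injective lam)
    (hlead : ∀ x, coeffFun A (Fin.last _) x = ∏ a, (x - z a))
    (hA : Annihilates (coeffFun A) (quasiSpan p lam)) {U : Submodule ℂ (ℂ → ℂ)}
    (hU : ∀ f ∈ U, Differentiable ℂ f) (hdim : Module.finrank ℂ U = L + 1)
    (hann : Annihilates (coeffFun A.transpose) U) :
    (∀ x, coeffFun A.transpose (Fin.last _) x = ∏ i, (x - lam i)) ∧
    (∀ u, IsSingularPoint (L + 1) U u → u ∈ Set.range lam) ∧
    (∀ i, exponents U (lam i) =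
      insert (((L + 1 : ℕ) : ℤ) - 1 + n i) (Set.Icc 0 (((L + 1 : ℕ) : ℤ) - 2))) := by
  have hAp : ∀ i x, ∑ j, coeffFun A j x *
      iteratedDeriv (j : ℕ) (quasiPoly (p i) (lam i)) x = 0 := fun i =>
    hA _ (Submodule.subset_span ⟨i, rfl⟩)
  have hpoly := coeffFun_transpose_last hlead hlam fun i =>
    coeffFun_transpose_last_eq_zero (hp i) (hAp i)
  have hlast : ∀ x, coeffFun A.transpose (Fin.last _) x = ∏ i, (x - lam i) := fun x => by
    rw [← eval_colPoly, hpoly, eval_prod]; simp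
  refine ⟨hlast, fun u hu => ?_, fun i => ?_⟩
  · by_contra hr
    refine hu (exponents_of_annihilates_of_ne_zero (continuous_coeffFun _) ?_ hU hdim hann)
    rw [hlast]
    exact Finset.prod_ne_zero_iff.2 fun i _ => sub_ne_zero.2 fun h => hr ⟨i, h.symm⟩
  · refine exponents_of_annihilates (β := fun x => ∏ k ∈ Finset.univ.erase i, (x - lam k))
      (continuous_coeffFun _) (by fun_prop) (fun y => ?_) ?_ ?_ hU hdim hann
    · rw [hlast, Finset.mul_prod_erase _ (fun k => y - lam k) (Finset.mem_univ i)]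
    · refine Finset.prod_ne_zero_iff.2 fun k hk => sub_ne_zero.2 fun h => ?_
      exact Finset.ne_of_mem_erase hk (hlam h).symm
    -- The derivative of `∏ (X - lam k)` at `lam i` is the product of the other factors, which is
    -- `β` there.
    · rw [coeffFun_transpose_residue (hp i) (hAp i), hpoly,
        ← Finset.mul_prod_erase _ (fun k => X - C (lam k)) (Finset.mem_univ i), derivative_mul]
      simp [eval_prod]

theorem isSpecialFundamentalOperator_iff {N M : ℕ} {z : Fin M → ℂ} {V : Submodule ℂ (ℂ → ℂ)}
    {A : Matrix (Fin (M + 1)) (Fin (N + 1)) ℂ} (hV : ∀ f ∈ V, Differentiable ℂ f)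
    (hdim : Module.finrank ℂ V = N) :
    IsSpecialFundamentalOperator z V A ↔
      (∀ x, coeffFun A (Fin.last _) x = ∏ a, (x - z a)) ∧ Annihilates (coeffFun A) V := by
  constructor
  · rintro ⟨c, hc, hA⟩
    constructor
    · refine congrFun (eq_of_codiscrete (continuous_coeffFun _ _) (by fun_prop) ?_)
      filter_upwards [hA (Fin.last _), hc.monic] with x h1 h2
      rw [h2, mul_one] at h1
      exact h1
    · intro f hf
      refine congrFun (eq_of_codiscrete (g := fun _ => 0) ?_ continuous_const ?_)
      · exact continuous_finsetSum _ fun j _ => (continuous_coeffFun A j).mul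
          (differentiable_iteratedDeriv (hV f hf) _).continuous
      · filter_upwards [eventually_all.2 hA, hc.annihilates f hf] with x h1 h2
        have h3 : ∀ j, coeffFun A j x = (∏ a, (x - z a)) * c j x := h1
        simp only [h3, mul_assoc]
        rw [← Finset.mul_sum, h2, mul_zero]
  · rintro ⟨h1, h2⟩
    have hne : ∀ᶠ x in codiscrete ℂ, ∏ a, (x - z a) ≠ 0 :=
      eventually_codiscrete_of_finite (Set.finite_range z) fun x hx =>
        Finset.prod_ne_zero_iff.2 fun a _ => sub_ne_zero.2 fun h => hx ⟨a, h.symm⟩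
    refine ⟨fun j x => coeffFun A j x / ∏ a, (x - z a), ⟨hdim, fun j x => ?_, ?_, ?_⟩, fun j => ?_⟩
    · refine MeromorphicAt.fun_div (AnalyticAt.meromorphicAt ?_) (AnalyticAt.meromorphicAt ?_)
      · unfold coeffFun
        fun_prop
      · fun_prop
    · filter_upwards [hne] with x hx
      rw [h1, div_self hx]
    · intro f hf
      refine Eventually.of_forall fun x => ?_
      simp only [div_mul_eq_mul_div]
      rw [← Finset.sum_div, h2 f hf x, zero_div]
    · filter_upwards [hne] with x hx
      rw [mul_div_cancel₀ _ hx]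
      rfl

/-! ### Circle integrals with exponential kernel -/

theorem hasDerivAt_circleIntegral_exp {g : ℂ → ℂ} {c : ℂ} {r : ℝ} (hr : 0 ≤ r)
    (hg : ContinuousOn g (Metric.sphere c r)) (u : ℂ) :
    HasDerivAt (fun u => ∮ x in C(c, r), Complex.exp (u * x) * g x)
      (∮ x in C(c, r), Complex.exp (u * x) * (x * g x)) u := by
  have hgc : Continuous fun θ => g (circleMap c r θ) :=
    hg.comp_continuous (continuous_circleMap c r) fun θ => circleMap_mem_sphere c hr θ
  have hc := continuous_circleMap c r
  have hc0 := continuous_circleMap 0 r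
  have hF : Continuous fun q : ℂ × ℝ => deriv (circleMap c r) q.2 *
      (Complex.exp (q.1 * circleMap c r q.2) * (circleMap c r q.2 * g (circleMap c r q.2))) := by
    simp only [deriv_circleMap]
    exact ((hc0.comp continuous_snd).mul continuous_const).mul ((Complex.continuous_exp.comp
      (continuous_fst.mul (hc.comp continuous_snd))).mul
      ((hc.comp continuous_snd).mul (hgc.comp continuous_snd)))
  have hF0 : ∀ v : ℂ, Continuous fun θ => deriv (circleMap c r) θ *
      (Complex.exp (v * circleMap c r θ) * g (circleMap c r θ)) := by
    intro v
    simp only [deriv_circleMap]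
    exact (hc0.mul continuous_const).mul ((Complex.continuous_exp.comp
      (continuous_const.mul hc)).mul hgc)
  obtain ⟨B, hB⟩ := ((isCompact_closedBall u 1).prod
    (isCompact_uIcc (a := (0 : ℝ)) (b := 2 * Real.pi))).exists_bound_of_continuousOn hF.continuousOn
  simp only [circleIntegral, smul_eq_mul]
  refine (intervalIntegral.hasDerivAt_integral_of_dominated_loc_of_deriv_le
    (F' := fun u θ => deriv (circleMap c r) θ *
      (Complex.exp (u * circleMap c r θ) * (circleMap c r θ * g (circleMap c r θ))))
    (bound := fun _ => B) (s := Metric.closedBall u 1)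
    (Metric.closedBall_mem_nhds u one_pos) ?_ ?_ ?_ ?_ ?_ ?_).2
  · exact Eventually.of_forall fun v => (hF0 v).aestronglyMeasurable
  · exact (hF0 u).intervalIntegrable _ _
  · exact (hF.comp (Continuous.prodMk continuous_const continuous_id)).aestronglyMeasurable
  · exact Eventually.of_forall fun θ hθ v hv =>
      hB (v, θ) ⟨hv, Set.uIoc_subset_uIcc hθ⟩
  · exact intervalIntegrable_const
  · refine Eventually.of_forall fun θ _ v _ => ?_
    have h1 : HasDerivAt (fun v => Complex.exp (v * circleMap c r θ))
        (Complex.exp (v * circleMap c r θ) * (1 * circleMap c r θ)) v :=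
      ((hasDerivAt_id v).mul_const _).cexp
    refine ((h1.mul_const (g (circleMap c r θ))).const_mul _).congr_deriv ?_
    ring

theorem iteratedDeriv_circleIntegral_exp {g : ℂ → ℂ} {c : ℂ} {r : ℝ} (hr : 0 ≤ r)
    (hg : ContinuousOn g (Metric.sphere c r)) (i : ℕ) :
    iteratedDeriv i (fun u => ∮ x in C(c, r), Complex.exp (u * x) * g x) =
      fun u => ∮ x in C(c, r), Complex.exp (u * x) * (x ^ i * g x) := by
  induction i with
  | zero => simp
  | succ i ih =>
    rw [iteratedDeriv_succ, ih]
    ext u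
    rw [(hasDerivAt_circleIntegral_exp hr (by fun_prop) u).deriv]
    simp only [pow_succ', mul_assoc]

/-- The transposed operator annihilates the Laplace transforms of the dual family. -/
theorem transpose_annihilates_circleIntegral {K M : ℕ} {F : Fin (K + 1) → ℂ → ℂ}
    (hF : ∀ k, Differentiable ℂ (F k)) {A : Matrix (Fin (M + 1)) (Fin (K + 1 + 1)) ℂ}
    {z : Fin M → ℂ} (hlead : ∀ x, coeffFun A (Fin.last _) x = ∏ a, (x - z a))
    (hA : ∀ k x, ∑ j, coeffFun A j x * iteratedDeriv (j : ℕ) (F k) x = 0)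
    {c : ℂ} {r : ℝ} (hr : 0 ≤ r) (hW : ∀ x ∈ Metric.sphere c r, wronskian F x ≠ 0)
    (hz : ∀ x ∈ Metric.sphere c r, x ∉ Set.range z) (k : Fin (K + 1)) (u : ℂ) :
    ∑ i, coeffFun A.transpose i u * iteratedDeriv (i : ℕ)
      (fun u => ∮ x in C(c, r), Complex.exp (u * x) * (dualFamily F k x * ∏ b, (x - z b)⁻¹)) u
      = 0 := by
  have hz' : ∀ x ∈ Metric.sphere c r, ∀ b, x - z b ≠ 0 := fun x hx b =>
    sub_ne_zero.2 fun h => hz x hx ⟨b, h.symm⟩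
  have hcont : ContinuousOn (fun x => dualFamily F k x * ∏ b, (x - z b)⁻¹)
      (Metric.sphere c r) := by
    refine ContinuousOn.mul (fun x hx =>
      (differentiableAt_inv_jets hF (hW x hx) _ _).continuousAt.continuousWithinAt) ?_
    exact continuousOn_finsetProd _ fun b _ => ContinuousOn.inv₀ (by fun_prop)
      fun x hx => hz' x hx b
  have hint : ∀ i : Fin (M + 1), CircleIntegrable (fun x => coeffFun A.transpose i u *
      (Complex.exp (u * x) * (x ^ (i : ℕ) * (dualFamily F k x * ∏ b, (x - z b)⁻¹)))) c r :=
    fun i => ContinuousOn.circleIntegrable hr (by fun_prop)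
  simp only [iteratedDeriv_circleIntegral_exp hr hcont, ← circleIntegral.integral_const_mul]
  rw [← circleIntegral.integral_fun_sum fun i _ => hint i,
    ← circleIntegral_dualFamily_eq_zero hF hA (φ := fun x => Complex.exp (u * x)) (by fun_prop)
      hr hW (fun x hx => by
        rw [hlead]; exact Finset.prod_ne_zero_iff.2 fun b _ => hz' x hx b) k]
  -- The integrands agree because both operators multiply `exp (u * x)` by `∑ A i j x^i u^j`.
  refine circleIntegral.integral_congr hr fun x hx => ?_
  simp only [hlead]
  simp only [iteratedDeriv_cexp_const_mul, coeffFun, Finset.sum_mul,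
    Matrix.transpose_apply, div_eq_mul_inv, Finset.prod_inv_distrib]
  rw [Finset.sum_comm]
  exact Finset.sum_congr rfl fun j _ => Finset.sum_congr rfl fun i _ => by ring

/-- The Laplace transform of a pole of order `μ + 1`. -/
theorem exists_circleIntegral_exp_eq {H : ℂ → ℂ} {c : ℂ} {r : ℝ} (hr : 0 < r)
    (hH : ∀ x ∈ Metric.closedBall c r, DifferentiableAt ℂ H x) (hHc : H c ≠ 0) (μ : ℕ) :
    ∃ q : ℂ[X], q.degree = μ ∧ ∀ u, (∮ x in C(c, r), Complex.exp (u * x) *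
      (H x / (x - c) ^ (μ + 1))) = quasiPoly q c u := by
  have hHa : AnalyticAt ℂ H c := by
    refine DifferentiableOn.analyticAt (s := Metric.closedBall c r)
      (fun x hx => (hH x hx).differentiableWithinAt) (Metric.closedBall_mem_nhds c hr)
  set t : ℂ := 2 * Real.pi * Complex.I / (μ.factorial : ℂ) with ht
  have ht0 : t ≠ 0 := by
    rw [ht]
    refine div_ne_zero ?_ (by exact_mod_cast μ.factorial_ne_zero)
    exact Complex.two_pi_I_ne_zero
  -- Cauchy's formula gives `t` times the `μ`-th derivative at `c` of `exp (u * x) * H x`; `q` is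
  -- read off from the Leibniz rule, and its top coefficient is `t * H c`.
  let q : ℂ[X] := ∑ k ∈ Finset.range (μ + 1),
    C (t * (μ.choose k * iteratedDeriv (μ - k) H c)) * X ^ k
  have hcoeff : q.coeff μ = t * H c := by
    simp only [q, finsetSum_coeff, coeff_C_mul_X_pow]
    rw [Finset.sum_eq_single μ]
    · simp
    · intro k _ hk
      simp [hk.symm]
    · simp
  have hle : q.degree ≤ μ := by
    refine (degree_sum_le _ _).trans (Finset.sup_le fun k hk =>
      (degree_C_mul_X_pow_le _ _).trans ?_)
    exact_mod_cast Nat.le_of_lt_succ (Finset.mem_range.1 hk)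
  refine ⟨q, degree_eq_of_le_of_coeff_ne_zero hle (by rw [hcoeff]; exact mul_ne_zero ht0 hHc),
    fun u => ?_⟩
  have h1 : DifferentiableOn ℂ ((fun x => Complex.exp (u * x)) * H) (Metric.closedBall c r) :=
    fun x hx => (DifferentiableAt.mul (by fun_prop) (hH x hx)).differentiableWithinAt
  have h2 := h1.circleIntegral_one_div_sub_center_pow_smul hr μ
  rw [iteratedDeriv_mul (by fun_prop) hHa.contDiffAt] at h2
  rw [show (fun x => Complex.exp (u * x) * (H x / (x - c) ^ (μ + 1))) =
    fun x => (1 / (x - c) ^ (μ + 1)) • ((fun x => Complex.exp (u * x)) * H) x from by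
      ext x; simp only [Pi.mul_apply, smul_eq_mul]; ring, h2]
  simp only [iteratedDeriv_cexp_const_mul, quasiPoly, q, eval_finsetSum, eval_mul, eval_C,
    eval_pow, eval_X, smul_eq_mul, Finset.sum_mul, Finset.mul_sum, mul_comm u c]
  exact Finset.sum_congr rfl fun k _ => by rw [ht]; ring

/-! ### The conjugate space and the integral transform -/

section Conjugate

variable {K : ℕ} {V : Submodule ℂ (ℂ → ℂ)} {G : Fin (K + 1) → ℂ → ℂ}

theorem span_range_eq_of_linearIndependent (hdim : Module.finrank ℂ V = K + 1)
    (hG : ∀ i, G i ∈ V) (hli : LinearIndependent ℂ G) :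
    Submodule.span ℂ (Set.range G) = V := by
  have : Module.Finite ℂ V := Module.finite_of_finrank_pos (by omega)
  refine Submodule.eq_of_le_of_finrank_le (Submodule.span_le.2 ?_) ?_
  · rintro _ ⟨i, rfl⟩
    exact hG i
  · rw [finrank_span_eq_card hli, Fintype.card_fin, hdim]

theorem conjugateSpace_le_span_dualFamily (hV : ∀ f ∈ V, Differentiable ℂ f)
    (hdim : Module.finrank ℂ V = K + 1) (hG : ∀ i, G i ∈ V) (hli : LinearIndependent ℂ G) :
    conjugateSpace (K + 1) V ≤ Submodule.span ℂ (Set.range (dualFamily G)) := by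
  have hspan := span_range_eq_of_linearIndependent hdim hG hli
  have hexp : ∀ f ∈ V, ∃ c : Fin (K + 1) → ℂ, f = ∑ k, c k • G k := fun f hf => by
    rw [← hspan] at hf
    obtain ⟨c, hc⟩ := (Submodule.mem_span_range_iff_exists_fun ℂ).1 hf
    exact ⟨c, hc.symm⟩
  refine Submodule.span_le.2 ?_
  rintro g ⟨b, f, hf, rfl⟩
  choose T hT using fun i => hexp (b i) (b i).2
  choose S hS using fun i : Fin K => hexp (f i) (hf i)
  refine (Submodule.mem_span_range_iff_exists_fun ℂ).2
    -- The first factor accounts for the change of basis from `G` to `b`, the second for the minors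
    -- of the coefficients of `f`.
    ⟨fun k => (Matrix.of T).det⁻¹ * ((-1) ^ (K + (k : ℕ)) *
      ((Matrix.of S).submatrix id k.succAbove).det), ?_⟩
  ext x
  have h1 := wronskian_div_wronskian (fun k => hV _ (hG k)) (f := f) (S := Matrix.of S) hS x
  have h2 : wronskian (fun i => (b i : ℂ → ℂ)) x = (Matrix.of T).det * wronskian G x :=
    wronskian_eq_det_mul (fun k => hV _ (hG k)) hT x
  change _ = wronskian (k := K) f x / wronskian (fun i => (b i : ℂ → ℂ)) x
  rw [h2, mul_comm, ← div_div, h1, div_eq_inv_mul, Finset.mul_sum, Finset.sum_apply]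
  exact Finset.sum_congr rfl fun k _ => by
    rw [Pi.smul_apply, smul_eq_mul, mul_assoc]

/-- The last dual function suffices: for an adapted family it alone has a nonzero integral. -/
theorem dualFamily_last_mem_conjugateSpace (hdim : Module.finrank ℂ V = K + 1)
    (hG : ∀ i, G i ∈ V) (hli : LinearIndependent ℂ G) :
    dualFamily G (Fin.last K) ∈ conjugateSpace (K + 1) V := by
  have hli' : LinearIndependent ℂ fun i => (⟨G i, hG i⟩ : V) :=
    LinearIndependent.of_comp V.subtype hli
  let b : Module.Basis (Fin (K + 1)) ℂ V :=
    basisOfLinearIndependentOfCardEqFinrank hli' (by rw [Fintype.card_fin, hdim])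
  refine Submodule.subset_span ⟨b, fun i => G (Fin.castSucc (n := K) i), fun i => hG _, ?_⟩
  ext x
  rw [dualFamily_last]
  simp only [b, coe_basisOfLinearIndependentOfCardEqFinrank]
  rfl

end Conjugate

theorem SmallRadii.eq_of_mem {M : ℕ} {z : Fin M → ℂ} {r : Fin M → ℝ} (hr : SmallRadii z r)
    {a b : Fin M} (h : z b ∈ Metric.closedBall (z a) (r a)) : b = a := by
  by_contra hb
  exact absurd ((hr a).2 b hb) (not_lt.2 (Metric.mem_closedBall.1 h))

theorem SmallRadii.notMem_range {M : ℕ} {z : Fin M → ℂ} {r : Fin M → ℝ} (hr : SmallRadii z r)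
    {a : Fin M} {x : ℂ} (h : x ∈ Metric.sphere (z a) (r a)) : x ∉ Set.range z := by
  rintro ⟨b, rfl⟩
  obtain rfl := hr.eq_of_mem (Metric.sphere_subset_closedBall h)
  rw [Metric.mem_sphere, dist_self] at h
  exact absurd (hr b).1 (by rw [← h]; exact lt_irrefl _)

/-- A zero at `y` would be a root of the polynomial Wronskian, whose multiplicity at an unmarked
point is zero by a second family, adapted to `y`. -/
theorem IsSpecialSpace.wronskian_ne_zero {K M : ℕ} {lam : Fin (K + 1) → ℂ} {z : Fin M → ℂ}
    {n : Fin (K + 1) → ℕ} {m : Fin M → ℕ} {V : Submodule ℂ (ℂ → ℂ)}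
    (hV : IsSpecialSpace lam z n m V) {G : Fin (K + 1) → ℂ → ℂ} {x : ℂ} {μ : ℕ}
    (hGV : ∀ i, G i ∈ V) (hG : IsAdapted G x μ) {y : ℂ} (hy : y ∉ Set.range z) :
    wronskian G y ≠ 0 := by
  obtain ⟨p, hp, rfl⟩ := hV.exists_quasiSpan
  obtain ⟨d, hd0, hd⟩ := exists_wronskian_eq_of_isAdapted hG hGV
  rw [wronskian, hd (fun j => (j : ℕ)) y]
  refine mul_ne_zero hd0 (mul_ne_zero (Complex.exp_ne_zero _) fun h0 => ?_)
  obtain ⟨ν, hν, -, F, hFV, hF⟩ := hV.exists_isAdapted y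
  have h1 := rootMultiplicity_polyWronskian hp hV.lam_injective hF hFV
  rw [hν hy] at h1
  exact absurd ((rootMultiplicity_pos (polyWronskian_ne_zero hp hV.lam_injective)).2 h0)
    (by rw [h1]; exact lt_irrefl _)

/-- The factorization of the integrands: all members but one of the dual family of an adapted
family give regular integrands at `z a`, and the last one gives a pole of order `m a + 1`. -/
theorem IsSpecialSpace.dualFamily_integrals {K M : ℕ} {lam : Fin (K + 1) → ℂ} {z : Fin M → ℂ}
    {n : Fin (K + 1) → ℕ} {m : Fin M → ℕ} {V : Submodule ℂ (ℂ → ℂ)}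
    (hV : IsSpecialSpace lam z n m V) {r : Fin M → ℝ} (hr : SmallRadii z r) (a : Fin M)
    {G : Fin (K + 1) → ℂ → ℂ} (hGV : ∀ i, G i ∈ V) (hG : IsAdapted G (z a) (m a)) :
    (∀ (k : Fin K) u, (∮ x in C(z a, r a), Complex.exp (u * x) *
      (dualFamily G k.castSucc x * ∏ b, (x - z b)⁻¹)) = 0) ∧
    ∃ q : ℂ[X], q.degree = m a ∧ ∀ u, (∮ x in C(z a, r a), Complex.exp (u * x) *
      (dualFamily G (Fin.last K) x * ∏ b, (x - z b)⁻¹)) = quasiPoly q (z a) u := by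
  obtain ⟨h, hh, hha, hWh⟩ := hG.hasZeroOfOrder_wronskian
  have hne : ∀ x ∈ Metric.closedBall (z a) (r a), h x ≠ 0 := by
    intro x hx
    by_cases hxr : x ∈ Set.range z
    · obtain ⟨b, rfl⟩ := hxr
      rwa [hr.eq_of_mem hx]
    · have := hV.wronskian_ne_zero hGV hG hxr
      rw [hWh] at this
      exact right_ne_zero_of_mul this
  have hprod : ∀ x ∈ Metric.closedBall (z a) (r a), DifferentiableAt ℂ
      (fun x => ∏ b ∈ Finset.univ.erase a, (x - z b)⁻¹) x := by
    intro x hx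
    refine DifferentiableAt.fun_finsetProd fun b hb => DifferentiableAt.inv (by fun_prop) ?_
    refine sub_ne_zero.2 fun hxb => Finset.ne_of_mem_erase hb ?_
    exact hr.eq_of_mem (hxb ▸ hx)
  have hsplit : ∀ x, ∏ b, (x - z b)⁻¹ = (x - z a)⁻¹ * ∏ b ∈ Finset.univ.erase a, (x - z b)⁻¹ :=
    fun x => (Finset.mul_prod_erase _ (fun b => (x - z b)⁻¹) (Finset.mem_univ a)).symm
  have hza : ∀ x ∈ Metric.sphere (z a) (r a), x - z a ≠ 0 := fun x hx =>
    sub_ne_zero.2 fun hxa => hr.notMem_range hx ⟨a, hxa.symm⟩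
  constructor
  · intro k u
    obtain ⟨g, hg, hgW⟩ := hG.vanishesTo_wronskian_succAbove k
    -- The quotient of Wronskians vanishes at `z a`, which cancels the simple pole of the weight;
    -- `Φ` is the resulting regular integrand, and Cauchy's theorem applies.
    let Φ : ℂ → ℂ := fun x => Complex.exp (u * x) * ((-1) ^ ((k.castSucc : ℕ) + K) * g x / h x *
      ∏ b ∈ Finset.univ.erase a, (x - z b)⁻¹)
    have hΦ : DifferentiableOn ℂ Φ (Metric.closedBall (z a) (r a)) := fun x hx =>
      (DifferentiableAt.mul (by fun_prop) (((hg x).const_mul _).fun_div (hh x) (hne x hx) |>.mul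
        (hprod x hx))).differentiableWithinAt
    rw [← ((hΦ.mono Metric.closure_ball_subset_closedBall).diffContOnCl).circleIntegral_eq_zero
      (hr a).1.le]
    refine circleIntegral.integral_congr (hr a).1.le fun x hx => ?_
    have h1 := hza x hx
    have h2 := hne x (Metric.sphere_subset_closedBall hx)
    simp only [Φ]
    rw [dualFamily_eq, hgW, hWh, hsplit, pow_succ]
    field_simp
  · have hw := differentiable_wronskian fun i : Fin K => hG.differentiable i.castSucc
    -- Here the numerator is nonzero at `z a`: the Wronskian contributes a pole of order `m a` and
    -- the weight one more.
    obtain ⟨q, hq, hqu⟩ := exists_circleIntegral_exp_eq (hr a).1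
      (H := fun x => wronskian (fun i : Fin K => G i.castSucc) x / h x *
        ∏ b ∈ Finset.univ.erase a, (x - z b)⁻¹)
      (fun x hx => ((hw x).fun_div (hh x) (hne x hx)).mul (hprod x hx)) (by
        refine mul_ne_zero (div_ne_zero hG.wronskian_castSucc_ne_zero hha) ?_
        refine Finset.prod_ne_zero_iff.2 fun b hb => inv_ne_zero (sub_ne_zero.2 fun hab => ?_)
        exact Finset.ne_of_mem_erase hb (hV.z_injective hab).symm) (m a)
    refine ⟨q, hq, fun u => ?_⟩
    rw [← hqu]
    refine circleIntegral.integral_congr (hr a).1.le fun x hx => ?_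
    have h1 := hza x hx
    have h2 := hne x (Metric.sphere_subset_closedBall hx)
    rw [dualFamily_last, hWh, hsplit, pow_succ]
    field_simp

/-- The special integral transform is spanned by quasi-polynomials and is annihilated by the
transposed operator. -/
theorem IsSpecialSpace.exists_transform_eq {K M : ℕ} {lam : Fin (K + 1) → ℂ} {z : Fin M → ℂ}
    {n : Fin (K + 1) → ℕ} {m : Fin M → ℕ} {V : Submodule ℂ (ℂ → ℂ)}
    (hV : IsSpecialSpace lam z n m V) {r : Fin M → ℝ} (hr : SmallRadii z r) :
    ∃ q : Fin M → ℂ[X], (∀ a, (q a).degree = m a) ∧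
      specialTransform (K + 1) V z r = quasiSpan q z ∧
      ∀ A : Matrix (Fin (M + 1)) (Fin (K + 1 + 1)) ℂ,
        (∀ x, coeffFun A (Fin.last _) x = ∏ a, (x - z a)) → Annihilates (coeffFun A) V →
        Annihilates (coeffFun A.transpose) (quasiSpan q z) := by
  have had : ∀ a, ∃ G : Fin (K + 1) → ℂ → ℂ, (∀ i, G i ∈ V) ∧ IsAdapted G (z a) (m a) := by
    intro a
    obtain ⟨μ, -, h2, h3⟩ := hV.exists_isAdapted (z a)
    rwa [h2 a rfl] at h3
  choose G hGV hG using had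
  have hW : ∀ a, ∀ x ∈ Metric.sphere (z a) (r a), wronskian (G a) x ≠ 0 := fun a x hx =>
    hV.wronskian_ne_zero (hGV a) (hG a) (hr.notMem_range hx)
  have hd : ∀ a i, Differentiable ℂ (G a i) := fun a => (hG a).differentiable
  have hli : ∀ a, LinearIndependent ℂ (G a) := by
    intro a
    obtain ⟨x, hx⟩ := NormedSpace.sphere_nonempty (x := z a) (r := r a) |>.2 (hr a).1.le
    exact linearIndependent_of_wronskian_ne_zero (hd a) (hW a x hx)
  have hint := fun a => hV.dualFamily_integrals hr a (hGV a) (hG a)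
  choose h0 q hq hqu using hint
  refine ⟨q, hq, le_antisymm ?_ ?_, ?_⟩
  · refine Submodule.span_le.2 ?_
    rintro g ⟨a, f, hf, rfl⟩
    obtain ⟨c, rfl⟩ := (Submodule.mem_span_range_iff_exists_fun ℂ).1
      (conjugateSpace_le_span_dualFamily hV.differentiable hV.finrank_eq (hGV a) (hli a) hf)
    have h1 : (fun u => ∮ x in C(z a, r a), Complex.exp (u * x) *
        (∑ k, c k • dualFamily (G a) k) x * ∏ b, (x - z b)⁻¹) =
        c (Fin.last K) • quasiPoly (q a) (z a) := by
      ext u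
      have hci : ∀ k, CircleIntegrable (fun x => c k * (Complex.exp (u * x) *
          (dualFamily (G a) k x * ∏ b, (x - z b)⁻¹))) (z a) (r a) := fun k => by
        refine ContinuousOn.circleIntegrable (hr a).1.le ?_
        refine continuousOn_const.mul (ContinuousOn.mul (by fun_prop) (ContinuousOn.mul
          (fun x hx => (differentiableAt_inv_jets (hd a) (hW a x hx) _ _).continuousAt
            |>.continuousWithinAt) ?_))
        exact continuousOn_finsetProd _ fun b _ => ContinuousOn.inv₀ (by fun_prop)
          fun x hx => sub_ne_zero.2 fun hxb => hr.notMem_range hx ⟨b, hxb.symm⟩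
      calc _ = ∮ x in C(z a, r a), ∑ k, c k * (Complex.exp (u * x) *
            (dualFamily (G a) k x * ∏ b, (x - z b)⁻¹)) := by
            congr 1
            ext x
            simp only [Finset.sum_apply, Pi.smul_apply, smul_eq_mul, Finset.mul_sum,
              Finset.sum_mul]
            exact Finset.sum_congr rfl fun k _ => by ring
        _ = _ := by
            rw [circleIntegral.integral_fun_sum fun k _ => hci k, Fin.sum_univ_castSucc]
            simp only [circleIntegral.integral_const_mul, h0, hqu]
            simp
    rw [h1]
    exact Submodule.smul_mem _ _ (Submodule.subset_span ⟨a, rfl⟩)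
  · refine Submodule.span_le.2 ?_
    rintro _ ⟨a, rfl⟩
    refine Submodule.subset_span ⟨a, dualFamily (G a) (Fin.last K),
      dualFamily_last_mem_conjugateSpace hV.finrank_eq (hGV a) (hli a), ?_⟩
    ext u
    simp only [← hqu, mul_assoc]
  · intro A hlead hA f hf u
    obtain ⟨c, rfl⟩ := (Submodule.mem_span_range_iff_exists_fun ℂ).1 hf
    have h1 : ∀ a, ∑ i, coeffFun A.transpose i u *
        iteratedDeriv (i : ℕ) (quasiPoly (q a) (z a)) u = 0 := by
      intro a
      rw [← transpose_annihilates_circleIntegral (hd a) hlead (fun k => hA _ (hGV a k))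
        (hr a).1.le (hW a) (fun x hx => hr.notMem_range hx) (Fin.last K) u, funext (hqu a)]
    simp only [iteratedDeriv_sum_smul (fun a => differentiable_quasiPoly (q a) (z a)),
      Finset.mul_sum]
    rw [Finset.sum_comm]
    refine Finset.sum_eq_zero fun a _ => ?_
    rw [← mul_zero (c a), ← h1 a, Finset.mul_sum]
    exact Finset.sum_congr rfl fun j _ => by ring

/-- The special integral transform of a special space is a special space of the dual type. -/
theorem IsSpecialSpace.dual {K L : ℕ} {lam : Fin (K + 1) → ℂ} {z : Fin (L + 1) → ℂ}
    {n : Fin (K + 1) → ℕ} {m : Fin (L + 1) → ℕ} {V : Submodule ℂ (ℂ → ℂ)}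
    (hV : IsSpecialSpace lam z n m V) {q : Fin (L + 1) → ℂ[X]} (hq : ∀ a, (q a).degree = m a)
    (hann : ∀ A : Matrix (Fin (L + 1 + 1)) (Fin (K + 1 + 1)) ℂ,
      (∀ x, coeffFun A (Fin.last _) x = ∏ a, (x - z a)) → Annihilates (coeffFun A) V →
      Annihilates (coeffFun A.transpose) (quasiSpan q z)) :
    IsSpecialSpace z lam m n (quasiSpan q z) := by
  obtain ⟨A, hlead, hA⟩ := hV.exists_operator
  obtain ⟨p, hp, rfl⟩ := hV.exists_quasiSpan
  obtain ⟨-, h2, h3⟩ := dual_exponents hp hV.lam_injective hlead hA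
    differentiable_of_mem_quasiSpan (finrank_quasiSpan hq hV.z_injective) (hann A hlead hA)
  exact ⟨hV.one_lt_M, hV.one_lt_N, hV.z_injective, hV.lam_injective, ⟨q, hq, rfl⟩, h2, h3⟩

end SpecialSpaces

/-! ### The duality theorem -/

theorem theorem3p1 {N M : ℕ} (lam : Fin N → ℂ) (z : Fin M → ℂ) (n : Fin N → ℕ) (m : Fin M → ℕ)
    (V U : Submodule ℂ (ℂ → ℂ)) (hV : SpecialSpaces.IsSpecialSpace lam z n m V)
    (r : Fin M → ℝ) (hr : SpecialSpaces.SmallRadii z r)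
    (hU : U = SpecialSpaces.specialTransform N V z r) :
    -- the dimension of the transform
    Module.finrank ℂ U = M ∧
    -- quasi-polynomials in the transform
    (∀ a, ∃ q : Polynomial ℂ, q.degree = m a ∧
      (fun u : ℂ => q.eval u * Complex.exp (z a * u)) ∈ U) ∧
    -- singular points and exponents of the transform
    (∀ u, SpecialSpaces.IsSingularPoint M U u → u ∈ Set.range lam) ∧
    (∀ i, SpecialSpaces.exponents U (lam i) =
      insert ((M : ℤ) - 1 + n i) (Set.Icc 0 ((M : ℤ) - 2))) ∧
    SpecialSpaces.IsSpecialSpace z lam m n U ∧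
    -- the special fundamental operators
    (∃ A : Matrix (Fin (M + 1)) (Fin (N + 1)) ℂ,
      SpecialSpaces.IsSpecialFundamentalOperator z V A) ∧
    (∀ A : Matrix (Fin (M + 1)) (Fin (N + 1)) ℂ,
      SpecialSpaces.IsSpecialFundamentalOperator z V A →
      SpecialSpaces.IsSpecialFundamentalOperator lam U A.transpose) ∧
    -- involutivity
    (∀ s : Fin N → ℝ, SpecialSpaces.SmallRadii lam s →
      SpecialSpaces.specialTransform M U lam s = V) := by
  obtain ⟨K, rfl⟩ : ∃ K, N = K + 1 := ⟨N - 1, by have := hV.one_lt_N; omega⟩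
  obtain ⟨L, rfl⟩ : ∃ L, M = L + 1 := ⟨M - 1, by have := hV.one_lt_M; omega⟩
  obtain ⟨q, hq, hUq, hann⟩ := hV.exists_transform_eq hr
  rw [hUq] at hU
  subst hU
  have hU := hV.dual hq hann
  have hVd := hV.differentiable
  have hUd := hU.differentiable
  obtain ⟨A, hlead, hA⟩ := hV.exists_operator
  obtain ⟨p, hp, hVp⟩ := hV.exists_quasiSpan
  have hlead' : ∀ B : Matrix (Fin (L + 1 + 1)) (Fin (K + 1 + 1)) ℂ,
      (∀ x, SpecialSpaces.coeffFun B (Fin.last _) x = ∏ a, (x - z a)) →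
      SpecialSpaces.Annihilates (SpecialSpaces.coeffFun B) V →
      ∀ x, SpecialSpaces.coeffFun B.transpose (Fin.last _) x = ∏ i, (x - lam i) :=
    fun B h1 h2 => (SpecialSpaces.dual_exponents hp hV.lam_injective h1 (hVp ▸ h2) hUd
      hU.finrank_eq (hann B h1 h2)).1
  refine ⟨hU.finrank_eq, fun a => ⟨q a, hq a, Submodule.subset_span ⟨a, rfl⟩⟩, hU.singular,
    hU.exponents_eq, hU, ⟨A, (SpecialSpaces.isSpecialFundamentalOperator_iff hVd
      hV.finrank_eq).2 ⟨hlead, hA⟩⟩, fun B hB => ?_, fun s hs => ?_⟩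
  · obtain ⟨h1, h2⟩ := (SpecialSpaces.isSpecialFundamentalOperator_iff hVd hV.finrank_eq).1 hB
    exact (SpecialSpaces.isSpecialFundamentalOperator_iff hUd hU.finrank_eq).2
      ⟨hlead' B h1 h2, hann B h1 h2⟩
  · obtain ⟨p', hp', hVp', hann'⟩ := hU.exists_transform_eq hs
    rw [hVp']
    -- Transposing twice returns `A`, so the second transform and `V` are annihilated by the same
    -- operator and have equal dimension.
    have h1 := hann' A.transpose (hlead' A hlead hA) (hann A hlead hA)
    rw [Matrix.transpose_transpose] at h1
    obtain ⟨x, hx⟩ : ∃ x, x ∉ Set.range z :=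
      ((Set.finite_range z).infinite_compl).nonempty
    refine SpecialSpaces.eq_of_annihilates (SpecialSpaces.continuous_coeffFun A) (x := x) ?_
      SpecialSpaces.differentiable_of_mem_quasiSpan hVd h1 hA
      (SpecialSpaces.finrank_quasiSpan hp' hV.lam_injective) hV.finrank_eq
    rw [hlead]
    exact Finset.prod_ne_zero_iff.2 fun a _ => sub_ne_zero.2 fun h => hx ⟨a, h.symm⟩
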